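/- Let $M$ be a finite-dimensional $C^\infty$-manifold (Hausdorff, second countable, connected), let $\mathbb{T}\subseteq\mathbb{R}$ be an interval, and let $\mathcal{P}$ be a topological space. Fix a smooth Riemannian metric on $M$ and a smooth connection $\nabla$ on $TM$ compatible with it (e.g. the Levi-Civita connection). For a locally Lipschitz vector field $\xi$ on $M$ let $$\operatorname{dil}\xi(x)=\inf_{\mathcal{U}}\ \sup\{\|\nabla_{v}\xi\| : y\in\operatorname{cl}(\mathcal{U}),\ \xi\text{ differentiable at }y,\ v\in T_yM,\ \|v\|=1\},$$ the infimum being over relatively compact neighbourhoods $\mathcal{U}$ of $x$, and for compact $K\subseteq M$ let $$p^{\rm lip}_K(\xi)=\max\{\sup_{x\in K}\operatorname{dil}\xi(x),\ \sup_{x\in K}\|\xi(x)\|\}.$$ Let $X\in\Gamma^{\rm lip}_{\rm PLI}(\mathbb{T};TM;\mathcal{P})$, i.e. $X:\mathbb{T}\times M\times\mathcal{P}\to TM$ with $X(t,x,p)\in T_xM$ is such that, writing $X^p_t=X(t,\cdot,p)$: * for each $p\in\mathcal{P}$, $X^p_t$ is a locally Lipschitz vector field for every $t\in\mathbb{T}$,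 $t\mapsto X(t,x,p)$ is measurable for every $x\in M$, and $t\mapsto p^{\rm lip}_K(X^p_t)$ is integrable over $\mathbb{S}$ for all compact $K\subseteq M$ and $\mathbb{S}\subseteq\mathbb{T}$; * $p\mapsto X(t,x,p)$ is continuous for all $(t,x)\in\mathbb{T}\times M$; * for all $p_0\in\mathcal{P}$, compact $K\subseteq M$ and $\mathbb{S}\subseteq\mathbb{T}$, and $\varepsilon>0$ there is a neighbourhood $\mathcal{O}$ of $p_0$ with $\int_{\mathbb{S}}p^{\rm lip}_K(X^p_t-X^{p_0}_t)\,dt<\varepsilon$ for $p\in\mathcal{O}$. An integral curve of $X^p$ is a locally absolutely continuous curve $\gamma:J\to M$ on an interval $J\subseteq\mathbb{T}$ with $\gamma'(t)=X(t,\gamma(t),p)$ for almost every $t\in J$. Let $D_X$ be the set of $(t_1,t_0,x,p)\in\mathbb{T}\times\mathbb{T}\times M\times\mathcal{P}$ for which there is an integral curve $\gamma$ of $X^p$, on an interval containing $t_0$ and $t_1$, with $\gamma(t_0)=x$; the flow is $\Phi^X:D_X\to M$, $\Phi^X(t_1,t_0,x,p)=\gamma(t_1)$. Write $|t_0,t_1|$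 for the closed interval with endpoints $t_0$ and $t_1$. Let $K\subseteq M$ be compact, let $t_0,t_1\in\mathbb{T}$, and let $p_0\in\mathcal{P}$ be such that $$|t_0,t_1|\times\{t_0\}\times K\times\{p_0\}\subseteq D_X.$$ Then there exists a neighbourhood $\mathcal{O}\subseteq\mathcal{P}$ of $p_0$ such that $\Phi^X$ is well-defined on $|t_0,t_1|\times\{t_0\}\times K\times\mathcal{O}$ (that is, this set is contained in $D_X$, and the value of $\Phi^X$ there does not depend on the choice of the integral curve) and $$\bigcup_{(t,x,p)\in|t_0,t_1|\times K\times\mathcal{O}}\Phi^X(t,t_0,x,p)$$ is precompact (has compact closure) in $M$. -/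

import Mathlib

open Set Filter MeasureTheory Bundle
open scoped Manifold ContDiff Topology ENNReal

noncomputable section

namespace LipFlow

/-! ### The `C^lip` seminorms on vector fields

`M` is a manifold modelled on `E`, with a Riemannian metric (the `RiemannianBundle` structure on
the tangent spaces, whose norm is `‖·‖`) and a connection `cov` on `TM`; `cov ξ y v` is `∇_v ξ`. -/

section Seminorms

variable {E : Type*} [NormedAddCommGroup E] [NormedSpace ℝ E]
  {M : Type*} [TopologicalSpace M] [ChartedSpace E M] [IsManifold 𝓘(ℝ, E) ∞ M]

/-- A vector field is locally Lipschitz if, around every point, its representative in the chart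
at that point is Lipschitz. -/
def IsLocallyLipschitz (ξ : Π x : M, TangentSpace 𝓘(ℝ, E) x) : Prop :=
  ∀ x₀ : M, ∃ C : NNReal, ∃ s ∈ 𝓝 (extChartAt 𝓘(ℝ, E) x₀ x₀),
    LipschitzOnWith C
      (fun u : E => (trivializationAt E (TangentSpace 𝓘(ℝ, E) : M → Type _) x₀
        ⟨(extChartAt 𝓘(ℝ, E) x₀).symm u, ξ ((extChartAt 𝓘(ℝ, E) x₀).symm u)⟩).2) s

/-- The vector field `ξ`, as a map from `M` to `TM`, is differentiable at `y`. -/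
def IsDifferentiableAt (ξ : Π x : M, TangentSpace 𝓘(ℝ, E) x) (y : M) : Prop :=
  MDifferentiableAt 𝓘(ℝ, E) (𝓘(ℝ, E).prod 𝓘(ℝ, E))
    (fun x : M => (⟨x, ξ x⟩ : TangentBundle 𝓘(ℝ, E) M)) y

variable [RiemannianBundle (fun x : M => TangentSpace 𝓘(ℝ, E) x)]
  (cov : CovariantDerivative 𝓘(ℝ, E) E (TangentSpace 𝓘(ℝ, E) : M → Type _))

/-- The connection is compatible with the Riemannian metric:
`d⟨σ, τ⟩(v) = ⟨∇_v σ, τ⟩ + ⟨σ, ∇_v τ⟩`. -/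
def IsMetricConnection : Prop :=
  ∀ (σ τ : Π x : M, TangentSpace 𝓘(ℝ, E) x) (y : M),
    IsDifferentiableAt σ y → IsDifferentiableAt τ y → ∀ v : TangentSpace 𝓘(ℝ, E) y,
      mfderiv 𝓘(ℝ, E) 𝓘(ℝ, ℝ) (fun x => inner ℝ (σ x) (τ x)) y v =
        inner ℝ (cov σ y v) (τ y) + inner ℝ (σ y) (cov τ y v)

/-- The supremum of `‖∇_v ξ‖` over the unit tangent vectors `v` at the points of `s` at which `ξ`
is differentiable. -/
def supCovDeriv (ξ : Π x : M, TangentSpace 𝓘(ℝ, E) x) (s : Set M) : ℝ≥0∞ :=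
  ⨆ (y : M) (_ : y ∈ s) (_ : IsDifferentiableAt ξ y)
    (v : TangentSpace 𝓘(ℝ, E) y) (_ : ‖v‖ = 1), ‖cov ξ y v‖ₑ

/-- The local sectional dilatation of a (locally Lipschitz) vector field at `x`: the infimum of
`supCovDeriv` over the closures of the relatively compact neighbourhoods of `x`. -/
def dil (ξ : Π x : M, TangentSpace 𝓘(ℝ, E) x) (x : M) : ℝ≥0∞ :=
  ⨅ (U : Set M) (_ : U ∈ 𝓝 x) (_ : IsCompact (closure U)), supCovDeriv cov ξ (closure U)

/-- The `C^lip` seminorm of a vector field over `K`: the maximum of the suprema over `K` of the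
local sectional dilatation and of the norm. -/
def lipSeminorm (K : Set M) (ξ : Π x : M, TangentSpace 𝓘(ℝ, E) x) : ℝ≥0∞ :=
  max (⨆ x ∈ K, dil cov ξ x) (⨆ x ∈ K, ‖ξ x‖ₑ)

/-- Membership in `Γ^lip_LI(T; TM)`: the time-dependent vector field `ξ` (whose values at times
outside `T` play no role) is locally Lipschitz at each time, measurable in time, and its
`C^lip` seminorms are integrable over compact subsets of `T`. Measurability in time is asked
only pointwise on `M`, the weakest of the usual requirements. -/
structure IsLocIntegrablyBounded (T : Set ℝ) (ξ : ℝ → Π x : M, TangentSpace 𝓘(ℝ, E) x) :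
    Prop where
  lip : ∀ t ∈ T, IsLocallyLipschitz (ξ t)
  meas : ∀ x : M, AEStronglyMeasurable (fun t => ξ t x) (volume.restrict T)
  integrable : ∀ K : Set M, IsCompact K → ∀ S : Set ℝ, IsCompact S → S ⊆ T →
    AEMeasurable (fun t => lipSeminorm cov K (ξ t)) (volume.restrict S) ∧
      ∫⁻ t in S, lipSeminorm cov K (ξ t) < ⊤

/-- Membership in `Γ^lip_PLI(T; TM; P)`; `X p t x` is the value at time `t`, point `x` and
parameter `p`. Besides being in `Γ^lip_LI` for each parameter, `X` is continuous in the parameter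
for each time and point, and `p ↦ X p` is continuous for the topology of `Γ^lip_LI(T; TM)`, which
is given by the seminorms `ξ ↦ ∫_S lipSeminorm K (ξ t) dt`. -/
structure IsParamLocIntegrablyBounded {P : Type*} [TopologicalSpace P] (T : Set ℝ)
    (X : P → ℝ → Π x : M, TangentSpace 𝓘(ℝ, E) x) : Prop where
  locIntegrablyBounded : ∀ p, IsLocIntegrablyBounded cov T (X p)
  continuous_param : ∀ t ∈ T, ∀ x : M, Continuous (fun p => X p t x)
  continuous_seminorm : ∀ p₀ : P, ∀ K : Set M, IsCompact K → ∀ S : Set ℝ, IsCompact S → S ⊆ T →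
    ∀ ε : ℝ≥0∞, 0 < ε → ∃ O ∈ 𝓝 p₀, ∀ p ∈ O,
      AEMeasurable (fun t => lipSeminorm cov K (X p t - X p₀ t)) (volume.restrict S) ∧
        ∫⁻ t in S, lipSeminorm cov K (X p t - X p₀ t) < ε

end Seminorms

/-! ### Integral curves, intervals of existence and flows -/

section Flows

variable {E : Type*} [NormedAddCommGroup E] [NormedSpace ℝ E]
  {M : Type*} [TopologicalSpace M] [ChartedSpace E M]

variable (E) in
/-- A curve in `M`, defined on the interval `J`, is locally absolutely continuous if its
composition with every smooth function is absolutely continuous on every compact subinterval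
of `J`. -/
def IsLocallyAC (γ : ℝ → M) (J : Set ℝ) : Prop :=
  ∀ f : M → ℝ, ContMDiff 𝓘(ℝ, E) 𝓘(ℝ, ℝ) ∞ f →
    ∀ a ∈ J, ∀ b ∈ J, AbsolutelyContinuousOnInterval (f ∘ γ) a b

/-- `γ`, restricted to the interval `J ⊆ T`, is an integral curve of the time-dependent vector
field `ξ`. The values of `γ` outside `J` play no role. -/
structure IsIntegralCurve (T : Set ℝ) (ξ : ℝ → Π x : M, TangentSpace 𝓘(ℝ, E) x)
    (J : Set ℝ) (γ : ℝ → M) : Prop where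
  ordConnected : J.OrdConnected
  subset : J ⊆ T
  locallyAC : IsLocallyAC E γ J
  hasDeriv : ∀ᵐ t ∂(volume.restrict J),
    HasMFDerivWithinAt 𝓘(ℝ, ℝ) 𝓘(ℝ, E) γ J t ((1 : ℝ →L[ℝ] ℝ).smulRight (ξ t (γ t)))

variable {P : Type*}

/-- The interval of existence `J_X(t₀, x₀, p₀)`: the union of the intervals that carry an integral
curve of `X p₀` with value `x₀` at `t₀`. -/
def existenceInterval (T : Set ℝ) (X : P → ℝ → Π x : M, TangentSpace 𝓘(ℝ, E) x)
    (t₀ : ℝ) (x₀ : M) (p₀ : P) : Set ℝ :=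
  ⋃₀ {J | ∃ γ : ℝ → M, IsIntegralCurve T (X p₀) J γ ∧ t₀ ∈ J ∧ γ t₀ = x₀}

/-- The domain `D_X` of the flow, a set of quadruples `(t₁, t₀, x₀, p₀)`. -/
def flowDomain (T : Set ℝ) (X : P → ℝ → Π x : M, TangentSpace 𝓘(ℝ, E) x) :
    Set (ℝ × ℝ × M × P) :=
  {q | q.1 ∈ T ∧ q.2.1 ∈ T ∧ q.1 ∈ existenceInterval T X q.2.1 q.2.2.1 q.2.2.2}

open Classical in
/-- The flow `Φ^X(t₁, t₀, x₀, p₀)`: the value at `t₁` of an integral curve of `X p₀` that is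
defined on an interval containing `t₀` and `t₁` and has value `x₀` at `t₀`. Off the domain
`flowDomain T X` it has the irrelevant value `x₀`. -/
def flow (T : Set ℝ) (X : P → ℝ → Π x : M, TangentSpace 𝓘(ℝ, E) x)
    (t₁ t₀ : ℝ) (x₀ : M) (p₀ : P) : M :=
  if h : ∃ (γ : ℝ → M) (J : Set ℝ),
      IsIntegralCurve T (X p₀) J γ ∧ t₀ ∈ J ∧ t₁ ∈ J ∧ γ t₀ = x₀
  then h.choose t₁ else x₀

end Flows

end LipFlow

end

/-! Locally this is continuous dependence for Carathéodory equations. Let `γ` be an integral curve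
of `X p₀`, and let `p` be near `p₀`. In a chart, `γ` almost solves the equation of `X p`: its defect
is bounded by the integral of the size of `X p - X p₀`, which is small by hypothesis. On a short
time interval the Picard operator of `X p` is a contraction, so a true solution lies close to `γ`
(`exists_solution_near`, `hasLocalFlow_of_chart`). Such steps are chained along `γ`, and
neighbourhoods are chosen backwards from the final time (`HasLocalFlow.trans`,
`IsIntegralCurve.hasLocalFlow`). Compactness of `K` then makes the neighbourhood of `p₀` uniform,
and all solutions stay in a finite union of compact sets.

The hypotheses only control `lipSeminorm`, which is built from the Riemannian norm and from the
covariant derivative at points of differentiability. `exists_chart_estimate` turns it into bounds on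
the size and the Lipschitz constant of the chart representative. Two facts carry it. The coordinate
derivative differs from the covariant one by bounded connection coefficients
(`fderiv_chartRep_apply`). A Lipschitz map whose derivative is bounded wherever it exists has that
bound as a Lipschitz constant (`norm_sub_le_of_norm_fderiv_le`, by Rademacher and Fubini).

Uniqueness (`IsIntegralCurve.eqOn_Icc`) identifies the constructed curves with the flow. -/

noncomputable section

namespace LipFlow

/-! ### Lipschitz constants from almost everywhere derivative bounds. -/

section Rademacher

variable {E F : Type*} [NormedAddCommGroup E] [NormedSpace ℝ E]
  [NormedAddCommGroup F] [NormedSpace ℝ F]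

/-- A mean value inequality for Lipschitz curves whose derivative is bounded almost everywhere. -/
theorem norm_sub_le_of_ae_hasDerivAt {g : ℝ → F} {K : NNReal} (hg : LipschitzWith K g) {L : ℝ}
    (hL : ∀ᵐ t : ℝ, t ∈ Ioc (0 : ℝ) 1 → ∃ g', HasDerivAt g g' t ∧ ‖g'‖ ≤ L) :
    ‖g 1 - g 0‖ ≤ L := by
  -- A norming functional reduces the claim to a real-valued Lipschitz function, which is absolutely
  -- continuous and hence the integral of its derivative.
  obtain ⟨φ, hφ, hφg⟩ := exists_dual_vector'' ℝ (g 1 - g 0)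
  have hlip : LipschitzWith (‖φ‖₊ * K) (φ ∘ g) := φ.lipschitz.comp hg
  have hac : AbsolutelyContinuousOnInterval (φ ∘ g) 0 1 :=
    (hlip.lipschitzOnWith (s := uIcc 0 1)).absolutelyContinuousOnInterval
  have h_int := hac.integral_deriv_eq_sub
  have hle : ‖∫ t in (0 : ℝ)..1, deriv (φ ∘ g) t‖ ≤ L * |1 - 0| := by
    refine intervalIntegral.norm_integral_le_of_norm_le_const_ae ?_
    filter_upwards [hL] with t ht hmem
    rw [uIoc_of_le zero_le_one] at hmem
    obtain ⟨g', hg', hb⟩ := ht hmem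
    have hd : HasDerivAt (φ ∘ g) (φ g') t := φ.hasFDerivAt.comp_hasDerivAt t hg'
    rw [hd.deriv]
    calc ‖φ g'‖ ≤ ‖φ‖ * ‖g'‖ := φ.le_opNorm g'
      _ ≤ 1 * ‖g'‖ := by gcongr
      _ ≤ L := by simpa using hb
  rw [h_int] at hle
  have : (φ ∘ g) 1 - (φ ∘ g) 0 = ‖g 1 - g 0‖ := by
    simp only [Function.comp_apply, ← map_sub]
    simpa using hφg
  rw [this] at hle
  simpa using hle

variable [FiniteDimensional ℝ E] [FiniteDimensional ℝ F]

/-- A Lipschitz function on a ball whose derivative is bounded by `L` wherever it exists is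
`L`-Lipschitz. -/
theorem norm_sub_le_of_norm_fderiv_le {f : E → F} {x₀ : E} {r : ℝ} (hr : 0 < r) {C : NNReal}
    (hf : LipschitzOnWith C f (Metric.closedBall x₀ r)) {L : ℝ}
    (hL : ∀ x ∈ Metric.ball x₀ r, DifferentiableAt ℝ f x → ‖fderiv ℝ f x‖ ≤ L)
    {u v : E} (hu : u ∈ Metric.closedBall x₀ r) (hv : v ∈ Metric.closedBall x₀ r) :
    ‖f u - f v‖ ≤ L * ‖u - v‖ := by
  let _ : MeasurableSpace E := borel E
  have _ : BorelSpace E := ⟨rfl⟩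
  let _ : MeasurableSpace F := borel F
  have _ : BorelSpace F := ⟨rfl⟩
  -- A global Lipschitz extension lets Rademacher's theorem be used on all of `E`; its worse
  -- constant never enters the final bound.
  obtain ⟨g, hg, hfg⟩ := hf.extend_finite_dimension
  let μ : Measure E := Measure.addHaar
  have hdiff : ∀ᵐ x ∂μ, DifferentiableAt ℝ g x := hg.ae_differentiableAt
  have hbd : ∀ x ∈ Metric.ball x₀ r, DifferentiableAt ℝ g x → ‖fderiv ℝ g x‖ ≤ L := by
    intro x hx hgx
    have heq : f =ᶠ[𝓝 x] g := by
      filter_upwards [Metric.isOpen_ball.mem_nhds hx] with y hy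
      exact hfg (Metric.ball_subset_closedBall hy)
    rw [← heq.fderiv_eq]
    exact hL x hx (hgx.congr_of_eventuallyEq heq)
  have key : ∀ u ∈ Metric.ball x₀ r, ∀ v ∈ Metric.ball x₀ r, ‖g u - g v‖ ≤ L * ‖u - v‖ := by
    intro u hu v hv
    -- The segment from `v` to `u` may lie in the exceptional null set. By Fubini and translation
    -- invariance, almost every translate of it meets that set only for a null set of parameters;
    -- the estimate then passes to the limit `z → 0`.
    have hae : ∀ᵐ z ∂μ, ∀ᵐ t : ℝ, DifferentiableAt ℝ g (v + t • (u - v) + z) := by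
      refine (Measure.ae_ae_comm (μ := μ) (ν := (volume : Measure ℝ))
        (p := fun z t => DifferentiableAt ℝ g (v + t • (u - v) + z)) ?_).2 ?_
      · have hm : Measurable fun q : E × ℝ => v + q.2 • (u - v) + q.1 := by fun_prop
        exact hm (measurableSet_of_differentiableAt ℝ g)
      · refine Eventually.of_forall fun t => ?_
        exact (eventually_add_left_iff μ (v + t • (u - v))).2 hdiff
    have hdense := Measure.dense_of_ae hae
    set G := {z : E | ∀ᵐ t : ℝ, DifferentiableAt ℝ g (v + t • (u - v) + z)} with hG
    have hne : (𝓝[G] (0 : E)).NeBot := mem_closure_iff_nhdsWithin_neBot.1 (hdense 0)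
    have hnear : ∀ᶠ z in 𝓝[G] (0 : E), ‖g (u + z) - g (v + z)‖ ≤ L * ‖u - v‖ := by
      have h1 : ∀ᶠ z in 𝓝 (0 : E), u + z ∈ Metric.ball x₀ r :=
        (Continuous.tendsto' (by fun_prop : Continuous fun z : E => u + z) 0 u (by simp)).eventually
          (Metric.isOpen_ball.mem_nhds hu)
      have h2 : ∀ᶠ z in 𝓝 (0 : E), v + z ∈ Metric.ball x₀ r :=
        (Continuous.tendsto' (by fun_prop : Continuous fun z : E => v + z) 0 v (by simp)).eventually
          (Metric.isOpen_ball.mem_nhds hv)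
      filter_upwards [nhdsWithin_le_nhds h1, nhdsWithin_le_nhds h2, self_mem_nhdsWithin]
        with z hz1 hz2 hzG
      have hlip : LipschitzWith (lipschitzExtensionConstant F * C * ‖u - v‖₊)
          (fun t : ℝ => g (v + t • (u - v) + z)) := by
        refine hg.comp (LipschitzWith.of_dist_le_mul fun s t => ?_)
        rw [dist_eq_norm, dist_eq_norm]
        have : v + s • (u - v) + z - (v + t • (u - v) + z) = (s - t) • (u - v) := by module
        rw [this, norm_smul, mul_comm]
        rfl
      have := norm_sub_le_of_ae_hasDerivAt (L := L * ‖u - v‖) hlip ?_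
      · have e1 : v + (1 : ℝ) • (u - v) + z = u + z := by module
        have e0 : v + (0 : ℝ) • (u - v) + z = v + z := by module
        simpa only [e1, e0] using this
      filter_upwards [hzG] with t ht hmem
      have hline : HasDerivAt (fun t : ℝ => v + t • (u - v) + z) (u - v) t := by
        simpa using (((hasDerivAt_id t).smul_const (u - v)).const_add v).add_const z
      refine ⟨_, ht.hasFDerivAt.comp_hasDerivAt t hline, ?_⟩
      have hmemb : v + t • (u - v) + z ∈ Metric.ball x₀ r := by
        have := (convex_ball x₀ r) hz1 hz2 hmem.1.le (by linarith [hmem.2] : 0 ≤ 1 - t) (by ring)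
        convert this using 1
        module
      exact ((fderiv ℝ g _).le_opNorm _).trans (by gcongr; exact hbd _ hmemb ht)
    have hlim : Tendsto (fun z => ‖g (u + z) - g (v + z)‖) (𝓝[G] (0 : E)) (𝓝 ‖g u - g v‖) := by
      have hgc := hg.continuous
      exact (Continuous.tendsto' (by fun_prop) 0 _ (by simp)).mono_left nhdsWithin_le_nhds
    exact le_of_tendsto hlim hnear
  have hclosed : IsClosed {q : E × E | ‖g q.1 - g q.2‖ ≤ L * ‖q.1 - q.2‖} := by
    have hgc := hg.continuous
    exact isClosed_le (by fun_prop) (by fun_prop)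
  have hsub : closure (Metric.ball x₀ r ×ˢ Metric.ball x₀ r) ⊆
      {q : E × E | ‖g q.1 - g q.2‖ ≤ L * ‖q.1 - q.2‖} :=
    closure_minimal (fun q hq => key _ hq.1 _ hq.2) hclosed
  rw [closure_prod_eq, closure_ball _ hr.ne'] at hsub
  have := hsub (mk_mem_prod hu hv)
  rw [hfg hu, hfg hv]
  exact this

end Rademacher

/-! ### Measurability of Carathéodory functions along curves. -/

section Measurability

variable {E F : Type*} [TopologicalSpace E] [NormedAddCommGroup F]

/-- A Carathéodory function composed with a continuous curve is measurable. -/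
theorem aestronglyMeasurable_comp_curve {μ : Measure ℝ} {f : ℝ → E → F} {B : Set E}
    (hmeas : ∀ x ∈ B, AEStronglyMeasurable (fun t => f t x) μ)
    (hcont : ∀ᵐ t ∂μ, ContinuousOn (f t) B) {u : ℝ → E} (hu : Continuous u)
    (huB : ∀ t, u t ∈ B) : AEStronglyMeasurable (fun t => f t (u t)) μ := by
  -- Time is rounded down to the grid of mesh `1 / (n + 1)`. On each of the countably many cells the
  -- spatial point is fixed, so `hmeas` applies there.
  let q : ℕ → ℝ → ℝ := fun n t => (⌊((n : ℝ) + 1) * t⌋ : ℝ) / ((n : ℝ) + 1)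
  have hq : ∀ t, Tendsto (fun n => q n t) atTop (𝓝 t) := by
    intro t
    rw [tendsto_iff_dist_tendsto_zero]
    refine squeeze_zero (fun _ => dist_nonneg) (fun n => ?_)
      tendsto_one_div_add_atTop_nhds_zero_nat
    have hn : (0 : ℝ) < (n : ℝ) + 1 := by positivity
    have h1 := Int.floor_le (((n : ℝ) + 1) * t)
    have h2 := Int.lt_floor_add_one (((n : ℝ) + 1) * t)
    have h3 : q n t - t = (⌊((n : ℝ) + 1) * t⌋ - ((n : ℝ) + 1) * t) / ((n : ℝ) + 1) := by
      simp only [q]; field_simp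
    rw [Real.dist_eq, h3, abs_div, abs_of_pos hn]
    gcongr
    rw [abs_le]
    constructor <;> linarith
  refine aestronglyMeasurable_of_tendsto_ae (u := atTop) (f := fun n t => f t (u (q n t))) ?_ ?_
  · intro n
    have hcover : (⋃ k : ℤ, {t : ℝ | ⌊((n : ℝ) + 1) * t⌋ = k}) = univ := by
      ext t; simp
    have hms : ∀ k : ℤ, MeasurableSet {t : ℝ | ⌊((n : ℝ) + 1) * t⌋ = k} := fun k =>
      (Int.measurable_floor.comp (measurable_const_mul ((n : ℝ) + 1))) (measurableSet_singleton k)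
    rw [← Measure.restrict_univ (μ := μ), ← hcover, aestronglyMeasurable_iUnion_iff]
    intro k
    refine ((hmeas (u ((k : ℝ) / ((n : ℝ) + 1))) (huB _)).restrict).congr ?_
    filter_upwards [ae_restrict_mem (hms k)] with t ht
    have ht' : ⌊((n : ℝ) + 1) * t⌋ = k := ht
    simp only [q, ht']
  · filter_upwards [hcont] with t ht
    have h1 : Tendsto (fun n => u (q n t)) atTop (𝓝[B] (u t)) :=
      tendsto_nhdsWithin_iff.2 ⟨(hu.tendsto t).comp (hq t), Eventually.of_forall fun n => huB _⟩
    exact (ht (u t) (huB t)).tendsto.comp h1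

end Measurability

/-! ### Picard iteration for Carathéodory equations. -/

section Caratheodory

variable {E : Type*} [NormedAddCommGroup E]

/-- The time-dependent vector field `f` satisfies the Carathéodory conditions on `[a, b] × B`, and
its Lipschitz constants are so small that the Picard operator is a contraction. -/
structure IsCaratheodory (f : ℝ → E → E) (B : Set E) (a b : ℝ) : Prop where
  meas : ∀ x ∈ B, AEStronglyMeasurable (fun t => f t x) (volume.restrict (Icc a b))
  cont : ∀ t ∈ Icc a b, ContinuousOn (f t) B
  bound : ∃ m : ℝ → ℝ≥0∞, (∀ t ∈ Icc a b, ∀ x ∈ B, ‖f t x‖ₑ ≤ m t) ∧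
    ∫⁻ t in Icc a b, m t < ⊤
  lip : ∃ ℓ : ℝ → ℝ≥0∞, (∀ t ∈ Icc a b, ∀ x ∈ B, ∀ y ∈ B, ‖f t x - f t y‖ₑ ≤ ℓ t * ‖x - y‖ₑ) ∧
    ∫⁻ t in Icc a b, ℓ t ≤ 2⁻¹

theorem uIcc_subset_Icc_of_mem {a b s t : ℝ} (hs : s ∈ Icc a b) (ht : t ∈ Icc a b) :
    uIcc s t ⊆ Icc a b := ordConnected_Icc.uIcc_subset hs ht

namespace IsCaratheodory

variable {f : ℝ → E → E} {B : Set E} {a b : ℝ}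

theorem integrableOn_comp (hf : IsCaratheodory f B a b) {u : ℝ → E}
    (hu : ContinuousOn u (Icc a b)) (huB : ∀ t ∈ Icc a b, u t ∈ B) :
    IntegrableOn (fun t => f t (u t)) (Icc a b) := by
  rcases lt_or_ge b a with hba | hab
  · simp [Icc_eq_empty_of_lt hba]
  obtain ⟨m, hm, hmint⟩ := hf.bound
  -- The measurability lemma wants a curve on all of `ℝ`, so `u` is extended by its end values.
  have hext : ∀ t ∈ Icc a b, IccExtend hab (fun s : Icc a b => u s) t = u t := fun t ht =>
    IccExtend_of_mem hab _ ht
  refine ⟨?_, ?_⟩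
  · have h := aestronglyMeasurable_comp_curve (μ := volume.restrict (Icc a b)) (f := f) (B := B)
      hf.meas ((ae_restrict_iff' measurableSet_Icc).2 (Eventually.of_forall hf.cont))
      (u := IccExtend hab (fun s : Icc a b => u s))
      (hu.domRestrict.Icc_extend' (h := hab)) (fun t => huB _ (projIcc a b hab t).2)
    refine h.congr ?_
    filter_upwards [ae_restrict_mem measurableSet_Icc] with t ht
    rw [hext t ht]
  · refine lt_of_le_of_lt ?_ hmint
    refine setLIntegral_mono' measurableSet_Icc fun t ht => hm t ht _ (huB t ht)

theorem intervalIntegrable_comp (hf : IsCaratheodory f B a b) {u : ℝ → E}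
    (hu : ContinuousOn u (Icc a b)) (huB : ∀ t ∈ Icc a b, u t ∈ B) {s t : ℝ} (hs : s ∈ Icc a b)
    (ht : t ∈ Icc a b) : IntervalIntegrable (fun t => f t (u t)) volume s t :=
  ((hf.integrableOn_comp hu huB).mono_set (uIcc_subset_Icc_of_mem hs ht)).intervalIntegrable

variable [NormedSpace ℝ E]

/-- The Picard operator halves uniform distances because the Lipschitz bounds integrate to at most
`2⁻¹`. As `ℓ` need not be measurable, it is the finiteness of `D` that lets the constant leave the
integral. -/
theorem enorm_integral_sub_le (hf : IsCaratheodory f B a b) {u v : ℝ → E}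
    (hu : ContinuousOn u (Icc a b)) (huB : ∀ t ∈ Icc a b, u t ∈ B)
    (hv : ContinuousOn v (Icc a b)) (hvB : ∀ t ∈ Icc a b, v t ∈ B) {s t : ℝ} (hs : s ∈ Icc a b)
    (ht : t ∈ Icc a b) {D : ℝ≥0∞} (hD : D ≠ ⊤) (huv : ∀ t ∈ Icc a b, ‖u t - v t‖ₑ ≤ D) :
    ‖(∫ r in s..t, f r (u r)) - ∫ r in s..t, f r (v r)‖ₑ ≤ 2⁻¹ * D := by
  obtain ⟨ℓ, hℓ, h_int⟩ := hf.lip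
  rw [← intervalIntegral.integral_sub (hf.intervalIntegrable_comp hu huB hs ht)
    (hf.intervalIntegrable_comp hv hvB hs ht)]
  have hsub : uIoc s t ⊆ Icc a b := uIoc_subset_uIcc.trans (uIcc_subset_Icc_of_mem hs ht)
  calc ‖∫ r in s..t, (f r (u r) - f r (v r))‖ₑ
      = ‖∫ r in uIoc s t, (f r (u r) - f r (v r))‖ₑ := by
        rw [← ofReal_norm, intervalIntegral.norm_intervalIntegral_eq, ofReal_norm]
    _ ≤ ∫⁻ r in uIoc s t, ‖f r (u r) - f r (v r)‖ₑ := enorm_integral_le_lintegral_enorm _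
    _ ≤ ∫⁻ r in Icc a b, ‖f r (u r) - f r (v r)‖ₑ := lintegral_mono_set hsub
    _ ≤ ∫⁻ r in Icc a b, ℓ r * D := setLIntegral_mono' measurableSet_Icc fun r hr =>
        (hℓ r hr _ (huB r hr) _ (hvB r hr)).trans (by gcongr; exact huv r hr)
    _ = (∫⁻ r in Icc a b, ℓ r) * D := lintegral_mul_const' _ _ hD
    _ ≤ 2⁻¹ * D := by gcongr

theorem norm_integral_sub_le (hf : IsCaratheodory f B a b) {u v : ℝ → E}
    (hu : ContinuousOn u (Icc a b)) (huB : ∀ t ∈ Icc a b, u t ∈ B)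
    (hv : ContinuousOn v (Icc a b)) (hvB : ∀ t ∈ Icc a b, v t ∈ B) {s t : ℝ} (hs : s ∈ Icc a b)
    (ht : t ∈ Icc a b) {D : ℝ} (hD : 0 ≤ D) (huv : ∀ t ∈ Icc a b, ‖u t - v t‖ ≤ D) :
    ‖(∫ r in s..t, f r (u r)) - ∫ r in s..t, f r (v r)‖ ≤ D / 2 := by
  have h := hf.enorm_integral_sub_le hu huB hv hvB hs ht (D := ENNReal.ofReal D) (by simp)
    (fun t ht => by rw [← ofReal_norm]; exact ENNReal.ofReal_le_ofReal (huv t ht))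
  have h2 : (2⁻¹ : ℝ≥0∞) * ENNReal.ofReal D = ENNReal.ofReal (D / 2) := by
    rw [ENNReal.ofReal_div_of_pos (by norm_num), ENNReal.div_eq_inv_mul]
    simp
  rw [h2, ← ofReal_norm] at h
  exact (ENNReal.ofReal_le_ofReal_iff (by positivity)).1 h

/-- Two solutions of the integral equation with the same initial value agree. -/
theorem eqOn_of_integral_eq (hf : IsCaratheodory f B a b) {u v : ℝ → E}
    (hu : ContinuousOn u (Icc a b)) (huB : ∀ t ∈ Icc a b, u t ∈ B)
    (hv : ContinuousOn v (Icc a b)) (hvB : ∀ t ∈ Icc a b, v t ∈ B) {s : ℝ} (hs : s ∈ Icc a b)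
    {x : E} (hux : ∀ t ∈ Icc a b, u t = x + ∫ r in s..t, f r (u r))
    (hvx : ∀ t ∈ Icc a b, v t = x + ∫ r in s..t, f r (v r)) : EqOn u v (Icc a b) := by
  -- At a maximum of `‖u - v‖` the contraction bound reads `D ≤ D / 2`, which forces `D = 0`.
  obtain ⟨t₁, ht₁, hmax⟩ := isCompact_Icc.exists_isMaxOn ⟨s, hs⟩ (hu.sub hv).norm
  have h := hf.norm_integral_sub_le hu huB hv hvB hs ht₁ (norm_nonneg (u t₁ - v t₁))
    (fun t ht => hmax ht)
  have h' : u t₁ - v t₁ = (∫ r in s..t₁, f r (u r)) - ∫ r in s..t₁, f r (v r) := by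
    conv_lhs => rw [hux t₁ ht₁, hvx t₁ ht₁]
    abel
  rw [← h'] at h
  have h0 : ‖u t₁ - v t₁‖ ≤ 0 := by linarith
  intro t ht
  exact sub_eq_zero.1 (norm_le_zero_iff.1 ((hmax ht : ‖u t - v t‖ ≤ _).trans h0))

/-- Existence of a solution of the integral equation near an approximate solution. -/
theorem exists_solution_near [CompleteSpace E] (hf : IsCaratheodory f B a b) {c : ℝ → E}
    (hc : ContinuousOn c (Icc a b)) {ρ : ℝ} (hρ : 0 ≤ ρ)
    (hcB : ∀ t ∈ Icc a b, Metric.closedBall (c t) ρ ⊆ B) {s : ℝ} (hs : s ∈ Icc a b) {x : E}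
    (hcx : ∀ t ∈ Icc a b, ‖x + (∫ r in s..t, f r (c r)) - c t‖ ≤ ρ / 2) :
    ∃ u : ℝ → E, ContinuousOn u (Icc a b) ∧
      ∀ t ∈ Icc a b, u t ∈ Metric.closedBall (c t) ρ ∧ u t = x + ∫ r in s..t, f r (u r) := by
  have hab : a ≤ b := hs.1.trans hs.2
  let c₀ : C(Icc a b, E) := ⟨fun t => c t, hc.domRestrict⟩
  let S := Metric.closedBall c₀ ρ
  let ext : C(Icc a b, E) → ℝ → E := fun u => IccExtend hab u
  have hextc : ∀ u : C(Icc a b, E), ContinuousOn (ext u) (Icc a b) := fun u =>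
    (u.continuous.Icc_extend' (h := hab)).continuousOn
  have hext : ∀ (u : C(Icc a b, E)) (t : Icc a b), ext u t = u t := fun u t =>
    IccExtend_of_mem hab _ t.2
  have hextB' : ∀ u ∈ S, ∀ t ∈ Icc a b, ext u t ∈ Metric.closedBall (c t) ρ := by
    intro u hu t ht
    have h1 : dist (u ⟨t, ht⟩) (c₀ ⟨t, ht⟩) ≤ ρ :=
      (ContinuousMap.dist_apply_le_dist _).trans (Metric.mem_closedBall.1 hu)
    rw [← hext u ⟨t, ht⟩] at h1
    exact h1
  have hextB : ∀ u ∈ S, ∀ t ∈ Icc a b, ext u t ∈ B := fun u hu t ht =>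
    hcB t ht (hextB' u hu t ht)
  have hcB' : ∀ t ∈ Icc a b, c t ∈ B := fun t ht =>
    hcB t ht (Metric.mem_closedBall_self hρ)
  have hcontInt : ∀ u ∈ S, Continuous fun t : Icc a b => x + ∫ r in s..t, f r (ext u r) := by
    intro u hu
    have h := intervalIntegral.continuousOn_primitive_interval'
      (hf.intervalIntegrable_comp (hextc u) (hextB u hu) (left_mem_Icc.2 hab) (right_mem_Icc.2 hab))
      (by rwa [uIcc_of_le hab])
    rw [uIcc_of_le hab] at h
    exact continuous_const.add h.domRestrict
  have hmaps : ∀ (u : C(Icc a b, E)) (hu : u ∈ S),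
      (⟨_, hcontInt u hu⟩ : C(Icc a b, E)) ∈ S := by
    intro u hu
    refine (ContinuousMap.dist_le hρ).2 fun t => ?_
    have h1 := hf.norm_integral_sub_le (hextc u) (hextB u hu) hc hcB' hs t.2 hρ
      (fun r hr => by simpa [dist_eq_norm] using hextB' u hu r hr)
    have h2 := hcx t t.2
    -- The radius `ρ` is spent in halves: one on the contraction estimate for `u` against `c`, one
    -- on the defect of `c`.
    have h3 : x + (∫ r in s..t, f r (ext u r)) - c t =
        ((∫ r in s..t, f r (ext u r)) - ∫ r in s..t, f r (c r)) +
          (x + (∫ r in s..t, f r (c r)) - c t) := by abel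
    change dist (x + ∫ r in s..t, f r (ext u r)) (c t) ≤ ρ
    rw [dist_eq_norm, h3]
    exact (norm_add_le _ _).trans (by linarith)
  let Φ : S → S := fun u => ⟨⟨_, hcontInt u u.2⟩, hmaps u u.2⟩
  have hΦ : ContractingWith 2⁻¹ Φ := by
    refine ⟨by rw [← NNReal.coe_lt_coe]; norm_num, LipschitzWith.of_dist_le_mul fun u v => ?_⟩
    refine (ContinuousMap.dist_le (by positivity)).2 fun t => ?_
    have h1 := hf.norm_integral_sub_le (hextc u) (hextB u u.2) (hextc v) (hextB v v.2) hs t.2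
      (dist_nonneg (x := u) (y := v)) (fun r hr => by
        rw [← dist_eq_norm, hext u.1 ⟨r, hr⟩, hext v.1 ⟨r, hr⟩]
        exact ContinuousMap.dist_apply_le_dist _)
    change dist (x + ∫ r in s..t, f r (ext u r)) (x + ∫ r in s..t, f r (ext v r)) ≤ _
    rw [dist_add_left, dist_eq_norm]
    refine h1.trans (le_of_eq ?_)
    simp [div_eq_inv_mul]
  have : CompleteSpace S := Metric.isClosed_closedBall.completeSpace_coe
  have : Nonempty S := ⟨⟨c₀, Metric.mem_closedBall_self hρ⟩⟩
  let w : S := ContractingWith.fixedPoint Φ hΦ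
  have hw : Φ w = w := hΦ.fixedPoint_isFixedPt
  refine ⟨ext w, hextc w, fun t ht => ⟨hextB' w w.2 t ht, ?_⟩⟩
  have h1 : (Φ w : C(Icc a b, E)) ⟨t, ht⟩ = (w : C(Icc a b, E)) ⟨t, ht⟩ := by rw [hw]
  rw [hext w.1 ⟨t, ht⟩, ← h1]
  rfl

end IsCaratheodory

end Caratheodory

/-! ### Absolute continuity by comparison. -/

section AbsoluteContinuity

theorem absolutelyContinuousOnInterval_of_dist_le {X Y : Type*} [PseudoMetricSpace X]
    [PseudoMetricSpace Y] {f : ℝ → X} {g : ℝ → Y} {a b : ℝ}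
    (hg : AbsolutelyContinuousOnInterval g a b)
    (h : ∀ s ∈ uIcc a b, ∀ t ∈ uIcc a b, dist (f s) (f t) ≤ dist (g s) (g t)) :
    AbsolutelyContinuousOnInterval f a b := by
  rw [absolutelyContinuousOnInterval_iff] at hg ⊢
  intro ε hε
  obtain ⟨δ, hδ, H⟩ := hg ε hε
  refine ⟨δ, hδ, fun I hI hlen => lt_of_le_of_lt ?_ (H I hI hlen)⟩
  exact Finset.sum_le_sum fun i hi => h _ (hI.1 i hi).1 _ (hI.1 i hi).2

/-- A Lipschitz function of a primitive is absolutely continuous. -/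
theorem absolutelyContinuousOnInterval_comp_primitive {E : Type*} [NormedAddCommGroup E]
    [NormedSpace ℝ E] {X : Type*} [PseudoMetricSpace X] {g : ℝ → E} {a b : ℝ}
    (hg : IntervalIntegrable g volume a b) {u : ℝ → E}
    (hu : ∀ s ∈ uIcc a b, ∀ t ∈ uIcc a b, u t - u s = ∫ r in s..t, g r) {F : E → X} {B : Set E}
    {K : NNReal} (hF : LipschitzOnWith K F B) (huB : ∀ t ∈ uIcc a b, u t ∈ B) :
    AbsolutelyContinuousOnInterval (F ∘ u) a b := by
  -- The comparison function is the primitive of `K * ‖g‖`, which dominates every increment of `F ∘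
  -- u`.
  have hG := (hg.norm.const_mul (K : ℝ)).absolutelyContinuousOnInterval_intervalIntegral
    (c := a) left_mem_uIcc
  refine absolutelyContinuousOnInterval_of_dist_le hG fun s hs t ht => ?_
  have hsub : ∀ {s t}, s ∈ uIcc a b → t ∈ uIcc a b → uIcc s t ⊆ uIcc a b := fun hs ht =>
    uIcc_subset_uIcc hs ht
  have hi : ∀ {t}, t ∈ uIcc a b → IntervalIntegrable (fun r => (K : ℝ) * ‖g r‖) volume a t :=
    fun ht => (hg.norm.const_mul (K : ℝ)).mono_set (hsub left_mem_uIcc ht)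
  rw [Function.comp_apply, Function.comp_apply, dist_comm (F (u s)), dist_comm (∫ v in a..s, (K : ℝ) * ‖g v‖)]
  calc dist (F (u t)) (F (u s)) ≤ K * dist (u t) (u s) := hF.dist_le_mul _ (huB t ht) _ (huB s hs)
    _ = K * ‖∫ r in s..t, g r‖ := by rw [dist_eq_norm, hu s hs t ht]
    _ ≤ K * |∫ r in s..t, ‖g r‖| := by
      gcongr; exact intervalIntegral.norm_integral_le_abs_integral_norm
    _ = |∫ r in s..t, (K : ℝ) * ‖g r‖| := by
      rw [intervalIntegral.integral_const_mul, abs_mul, abs_of_nonneg K.coe_nonneg]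
    _ = _ := by
      rw [Real.dist_eq, intervalIntegral.integral_interval_sub_left (hi ht) (hi hs)]

end AbsoluteContinuity

/-! ### Calculus of locally Lipschitz maps. -/

section LipschitzNear

variable {E F G : Type*} [NormedAddCommGroup E] [NormedAddCommGroup F] [NormedAddCommGroup G]

/-- `f` is Lipschitz on some neighbourhood of `u`. -/
def LipschitzNear (f : E → F) (u : E) : Prop :=
  ∃ C : NNReal, ∃ s ∈ 𝓝 u, LipschitzOnWith C f s

theorem LipschitzNear.continuousAt {f : E → F} {u : E} (hf : LipschitzNear f u) :
    ContinuousAt f u := by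
  obtain ⟨C, s, hs, h⟩ := hf
  exact h.continuousOn.continuousAt hs

theorem LipschitzNear.comp {g : F → G} {f : E → F} {u : E} (hg : LipschitzNear g (f u))
    (hf : LipschitzNear f u) : LipschitzNear (fun x => g (f x)) u := by
  have hfc := hf.continuousAt
  obtain ⟨C, s, hs, h⟩ := hf
  obtain ⟨C', s', hs', h'⟩ := hg
  exact ⟨C' * C, s ∩ f ⁻¹' s', inter_mem hs (hfc hs'),
    h'.comp (h.mono inter_subset_left) fun x hx => hx.2⟩

theorem LipschitzNear.prodMk {g : E → G} {f : E → F} {u : E} (hf : LipschitzNear f u)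
    (hg : LipschitzNear g u) : LipschitzNear (fun x => (f x, g x)) u := by
  obtain ⟨C, s, hs, h⟩ := hf
  obtain ⟨C', s', hs', h'⟩ := hg
  exact ⟨max C C', s ∩ s', inter_mem hs hs',
    (h.mono inter_subset_left).prodMk (h'.mono inter_subset_right)⟩

theorem LipschitzNear.congr {f g : E → F} {u : E} (hf : LipschitzNear f u) (hfg : f =ᶠ[𝓝 u] g) :
    LipschitzNear g u := by
  obtain ⟨C, s, hs, h⟩ := hf
  refine ⟨C, s ∩ {x | f x = g x}, inter_mem hs hfg, fun x hx y hy => ?_⟩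
  rw [← hx.2, ← hy.2]
  exact h hx.1 hy.1

theorem LipschitzNear.sub {f g : E → F} {u : E} (hf : LipschitzNear f u)
    (hg : LipschitzNear g u) : LipschitzNear (fun x => f x - g x) u := by
  obtain ⟨C, s, hs, h⟩ := hf
  obtain ⟨C', s', hs', h'⟩ := hg
  exact ⟨C + C', s ∩ s', inter_mem hs hs',
    (h.mono inter_subset_left).sub (h'.mono inter_subset_right)⟩

variable [NormedSpace ℝ F] [NormedSpace ℝ G]

theorem lipschitzNear_of_contDiffAt [NormedSpace ℝ E] {f : E → F} {u : E} {n : ℕ∞ω}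
    (hf : ContDiffAt ℝ n f u)
    (hn : n ≠ 0) : LipschitzNear f u :=
  (hf.of_le (ENat.one_le_iff_ne_zero_withTop.mpr hn)).exists_lipschitzOnWith

theorem LipschitzNear.clm_apply {A : E → F →L[ℝ] G} {h : E → F} {u : E} (hA : LipschitzNear A u)
    (hh : LipschitzNear h u) : LipschitzNear (fun x => A x (h x)) u := by
  have hev : LipschitzNear (fun q : (F →L[ℝ] G) × F => q.1 q.2) (A u, h u) :=
    lipschitzNear_of_contDiffAt (n := 1)
      (isBoundedBilinearMap_apply (𝕜 := ℝ) (E := F) (F := G)).contDiff.contDiffAt one_ne_zero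
  exact LipschitzNear.comp (f := fun x => (A x, h x)) hev (hA.prodMk hh)

end LipschitzNear

/-! ### Vector fields in charts. -/

section ChartRep

variable {E : Type*} [NormedAddCommGroup E] [NormedSpace ℝ E]
  {M : Type*} [TopologicalSpace M] [ChartedSpace E M]

theorem extChartAt_symm_mem_source (y₀ : M) {u : E} (hu : u ∈ (extChartAt 𝓘(ℝ, E) y₀).target) :
    (extChartAt 𝓘(ℝ, E) y₀).symm u ∈ (chartAt E y₀).source := by
  have := (extChartAt 𝓘(ℝ, E) y₀).map_target hu
  rwa [extChartAt_source] at this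

variable [IsManifold 𝓘(ℝ, E) ∞ M]

/-- The representative of a vector field in the chart at `y₀`. -/
def chartRep (y₀ : M) (ξ : Π x : M, TangentSpace 𝓘(ℝ, E) x) (u : E) : E :=
  (trivializationAt E (TangentSpace 𝓘(ℝ, E) : M → Type _) y₀
    ⟨(extChartAt 𝓘(ℝ, E) y₀).symm u, ξ ((extChartAt 𝓘(ℝ, E) y₀).symm u)⟩).2

theorem chartRep_eq (y₀ : M) (ξ : Π x : M, TangentSpace 𝓘(ℝ, E) x) {u : E}
    (hu : u ∈ (extChartAt 𝓘(ℝ, E) y₀).target) :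
    chartRep y₀ ξ u = (trivializationAt E (TangentSpace 𝓘(ℝ, E) : M → Type _)
      y₀).continuousLinearMapAt ℝ ((extChartAt 𝓘(ℝ, E) y₀).symm u)
        (ξ ((extChartAt 𝓘(ℝ, E) y₀).symm u)) := by
  rw [Trivialization.continuousLinearMapAt_apply, Trivialization.coe_linearMapAt_of_mem]
  · rfl
  · exact extChartAt_symm_mem_source y₀ hu

theorem chartRep_sub (y₀ : M) (ξ η : Π x : M, TangentSpace 𝓘(ℝ, E) x) {u : E}
    (hu : u ∈ (extChartAt 𝓘(ℝ, E) y₀).target) :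
    chartRep y₀ (ξ - η) u = chartRep y₀ ξ u - chartRep y₀ η u := by
  rw [chartRep_eq _ _ hu, chartRep_eq _ _ hu, chartRep_eq _ _ hu, ← map_sub]
  rfl

theorem isLocallyLipschitz_iff {ξ : Π x : M, TangentSpace 𝓘(ℝ, E) x} :
    IsLocallyLipschitz ξ ↔ ∀ x₀ : M, LipschitzNear (chartRep x₀ ξ) (extChartAt 𝓘(ℝ, E) x₀ x₀) :=
  Iff.rfl

theorem IsLocallyLipschitz.sub {ξ η : Π x : M, TangentSpace 𝓘(ℝ, E) x}
    (hξ : IsLocallyLipschitz ξ) (hη : IsLocallyLipschitz η) : IsLocallyLipschitz (ξ - η) := by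
  rw [isLocallyLipschitz_iff] at *
  intro x₀
  refine ((hξ x₀).sub (hη x₀)).congr ?_
  filter_upwards [extChartAt_target_mem_nhds (I := 𝓘(ℝ, E)) x₀] with u hu
  rw [chartRep_sub _ _ _ hu]

/-- The representative of a locally Lipschitz vector field in any chart is locally Lipschitz. -/
theorem IsLocallyLipschitz.lipschitzNear_chartRep {ξ : Π x : M, TangentSpace 𝓘(ℝ, E) x}
    (hξ : IsLocallyLipschitz ξ) (y₀ : M) {u : E} (hu : u ∈ (extChartAt 𝓘(ℝ, E) y₀).target) :
    LipschitzNear (chartRep y₀ ξ) u := by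
  -- `IsLocallyLipschitz` speaks only of the centre of each chart, so the point is viewed in the
  -- chart centred at itself and transported by the smooth transition map `ψ` and the coordinate
  -- change `A`.
  set y₁ := (extChartAt 𝓘(ℝ, E) y₀).symm u with hy₁
  have hy₁s : y₁ ∈ (chartAt E y₀).source := extChartAt_symm_mem_source y₀ hu
  let e₀ := trivializationAt E (TangentSpace 𝓘(ℝ, E) : M → Type _) y₀
  let e₁ := trivializationAt E (TangentSpace 𝓘(ℝ, E) : M → Type _) y₁
  let ψ : E → E := fun v => extChartAt 𝓘(ℝ, E) y₁ ((extChartAt 𝓘(ℝ, E) y₀).symm v)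
  let A : E → E →L[ℝ] E := fun v => (e₁.coordChangeL ℝ e₀ ((extChartAt 𝓘(ℝ, E) y₀).symm v) :
    E →L[ℝ] E)
  have hsymm : ContMDiffAt 𝓘(ℝ, E) 𝓘(ℝ, E) ∞ (extChartAt 𝓘(ℝ, E) y₀).symm u :=
    (contMDiffOn_extChartAt_symm y₀).contMDiffAt ((isOpen_extChartAt_target y₀).mem_nhds hu)
  have hψ : ContDiffAt ℝ ∞ ψ u := by
    rw [← contMDiffAt_iff_contDiffAt]
    exact (contMDiffAt_extChartAt (x := y₁)).comp u hsymm
  have hA : ContDiffAt ℝ ∞ A u := by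
    rw [← contMDiffAt_iff_contDiffAt]
    have h := contMDiffOn_coordChangeL (IB := 𝓘(ℝ, E)) (n := ∞) e₁ e₀
    have hmem : y₁ ∈ e₁.baseSet ∩ e₀.baseSet := ⟨mem_chart_source E y₁, hy₁s⟩
    exact (h.contMDiffAt ((e₁.open_baseSet.inter e₀.open_baseSet).mem_nhds hmem)).comp u hsymm
  have h1 : LipschitzNear (fun v => A v (chartRep y₁ ξ (ψ v))) u := by
    refine (lipschitzNear_of_contDiffAt hA (by simp)).clm_apply ?_
    exact LipschitzNear.comp (f := ψ) (g := chartRep y₁ ξ) (isLocallyLipschitz_iff.1 hξ y₁)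
      (lipschitzNear_of_contDiffAt hψ (by simp))
  refine h1.congr ?_
  have hnear : ∀ᶠ v in 𝓝 u, (extChartAt 𝓘(ℝ, E) y₀).symm v ∈ (chartAt E y₁).source :=
    hsymm.continuousAt ((chartAt E y₁).open_source.mem_nhds (mem_chart_source E y₁))
  filter_upwards [hnear, (isOpen_extChartAt_target (I := 𝓘(ℝ, E)) y₀).mem_nhds hu] with v hv hvt
  have hv0 := extChartAt_symm_mem_source y₀ hvt
  have hψv : (extChartAt 𝓘(ℝ, E) y₁).symm (ψ v) = (extChartAt 𝓘(ℝ, E) y₀).symm v :=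
    (extChartAt 𝓘(ℝ, E) y₁).left_inv (by rwa [extChartAt_source])
  have hmem : (extChartAt 𝓘(ℝ, E) y₀).symm v ∈ e₁.baseSet ∩ e₀.baseSet := ⟨hv, hv0⟩
  change e₁.coordChangeL ℝ e₀ ((extChartAt 𝓘(ℝ, E) y₀).symm v) (chartRep y₁ ξ (ψ v)) = _
  rw [Trivialization.coordChangeL_apply e₁ e₀ hmem]
  unfold chartRep
  rw [hψv]
  have := e₁.symm_apply_apply_mk hmem.1 (ξ ((extChartAt 𝓘(ℝ, E) y₀).symm v))
  change (e₀ ⟨_, e₁.symm _ (e₁ ⟨_, ξ ((extChartAt 𝓘(ℝ, E) y₀).symm v)⟩).2⟩).2 = _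
  rw [this]

end ChartRep

/-! ### The covariant derivative in coordinates. -/

section CovariantDerivative

variable {E : Type*} [NormedAddCommGroup E] [NormedSpace ℝ E]
  {M : Type*} [TopologicalSpace M] [ChartedSpace E M] [IsManifold 𝓘(ℝ, E) ∞ M]

/-- Induction with the Leibniz rule. Differentiability is carried along because additivity of `cov`
requires it of both summands. -/
theorem cov_sum_smul (cov : CovariantDerivative 𝓘(ℝ, E) E (TangentSpace 𝓘(ℝ, E) : M → Type _))
    {ι : Type*} (s : Finset ι) {g : ι → Π x : M, TangentSpace 𝓘(ℝ, E) x} {h : ι → M → ℝ} {y : M}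
    (hg : ∀ i, IsDifferentiableAt (g i) y)
    (hh : ∀ i, MDifferentiableAt 𝓘(ℝ, E) 𝓘(ℝ, ℝ) (h i) y) :
    IsDifferentiableAt (∑ i ∈ s, h i • g i) y ∧
      cov (∑ i ∈ s, h i • g i) y =
        ∑ i ∈ s, (h i y • cov (g i) y + (mvfderiv 𝓘(ℝ, E) (h i) y).smulRight (g i y)) := by
  classical
  induction s using Finset.induction_on with
  | empty =>
    refine ⟨?_, ?_⟩
    · exact mdifferentiableAt_zeroSection ..
    · simp
  | insert a s ha ih =>
    have hd : IsDifferentiableAt (h a • g a) y := MDifferentiableAt.smul_section (hh a) (hg a)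
    rw [Finset.sum_insert ha, Finset.sum_insert ha]
    refine ⟨mdifferentiableAt_add_section hd ih.1, ?_⟩
    rw [cov.isCovariantDerivativeOn.add hd ih.1 (mem_univ y), ih.2,
      cov.isCovariantDerivativeOn.leibniz (hg a) (hh a) (mem_univ y)]

theorem isDifferentiableAt_of_chartRep {y₀ y : M} (hy : y ∈ (chartAt E y₀).source)
    {ξ : Π x : M, TangentSpace 𝓘(ℝ, E) x}
    (hξ : DifferentiableAt ℝ (chartRep y₀ ξ) (extChartAt 𝓘(ℝ, E) y₀ y)) :
    IsDifferentiableAt ξ y := by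
  let e := trivializationAt E (TangentSpace 𝓘(ℝ, E) : M → Type _) y₀
  refine (e.mdifferentiableAt_section_iff 𝓘(ℝ, E) ξ (b₀ := y) hy).2 ?_
  have h1 : MDifferentiableAt 𝓘(ℝ, E) 𝓘(ℝ, E)
      (fun x => chartRep y₀ ξ (extChartAt 𝓘(ℝ, E) y₀ x)) y :=
    hξ.mdifferentiableAt.comp y (mdifferentiableAt_extChartAt hy)
  refine h1.congr_of_eventuallyEq ?_
  filter_upwards [(chartAt E y₀).open_source.mem_nhds hy] with x hx
  unfold chartRep
  rw [(extChartAt 𝓘(ℝ, E) y₀).left_inv (by rwa [extChartAt_source])]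

variable [FiniteDimensional ℝ E]

/-- Near every point, the coordinate frame extends to global smooth vector fields. -/
theorem exists_contMDiff_eventuallyEq_localFrame [T2Space M] {ι : Type*} (b : Module.Basis ι ℝ E)
    (y₀ : M) :
    ∃ g : ι → Π x : M, TangentSpace 𝓘(ℝ, E) x,
      (∀ i, ContMDiff 𝓘(ℝ, E) (𝓘(ℝ, E).prod 𝓘(ℝ, E)) ∞
        (fun x => (⟨x, g i x⟩ : TangentBundle 𝓘(ℝ, E) M))) ∧
      ∀ᶠ y in 𝓝 y₀, ∀ i, g i y =
        (trivializationAt E (TangentSpace 𝓘(ℝ, E) : M → Type _) y₀).localFrame b i y := by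
  let e := trivializationAt E (TangentSpace 𝓘(ℝ, E) : M → Type _) y₀
  obtain ⟨ψ⟩ := (inferInstance : Nonempty (SmoothBumpFunction 𝓘(ℝ, E) y₀))
  -- A bump function cuts the frame off inside the chart domain; this produces global sections, to
  -- which `cov` and its smoothness apply.
  refine ⟨fun i => (ψ : M → ℝ) • e.localFrame b i, fun i => ?_, ?_⟩
  · refine ContMDiffOn.smul_section_of_tsupport (u := (chartAt E y₀).source)
      ψ.contMDiff.contMDiffOn (chartAt E y₀).open_source ψ.tsupport_subset_chartAt_source ?_
    exact e.contMDiffOn_localFrame_baseSet ∞ b i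
  · filter_upwards [ψ.eventuallyEq_one] with y hy i
    simp [hy, e]

/-- The covariant derivative in the chart at `y₀`: the derivative of the representative of a vector
field is the representative of its covariant derivative, up to the connection coefficients. -/
theorem fderiv_chartRep_apply
    (cov : CovariantDerivative 𝓘(ℝ, E) E (TangentSpace 𝓘(ℝ, E) : M → Type _))
    {ι : Type*} [Fintype ι] (b : Module.Basis ι ℝ E) {y₀ y : M} (hy : y ∈ (chartAt E y₀).source)
    {g : ι → Π x : M, TangentSpace 𝓘(ℝ, E) x} (hgd : ∀ i, IsDifferentiableAt (g i) y)
    (hg : ∀ᶠ x in 𝓝 y, ∀ i, g i x =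
        (trivializationAt E (TangentSpace 𝓘(ℝ, E) : M → Type _) y₀).localFrame b i x)
    {ξ : Π x : M, TangentSpace 𝓘(ℝ, E) x}
    (hξ : DifferentiableAt ℝ (chartRep y₀ ξ) (extChartAt 𝓘(ℝ, E) y₀ y)) (w : E) :
    let e := trivializationAt E (TangentSpace 𝓘(ℝ, E) : M → Type _) y₀
    fderiv ℝ (chartRep y₀ ξ) (extChartAt 𝓘(ℝ, E) y₀ y) w =
      e.continuousLinearMapAt ℝ y (cov ξ y (e.symmL ℝ y w)) -
        ∑ i, b.repr (chartRep y₀ ξ (extChartAt 𝓘(ℝ, E) y₀ y)) i •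
          e.continuousLinearMapAt ℝ y (cov (g i) y (e.symmL ℝ y w)) := by
  intro e
  have hye : y ∈ e.baseSet := hy
  let h : ι → M → ℝ := fun i x => b.coord i (chartRep y₀ ξ (extChartAt 𝓘(ℝ, E) y₀ x))
  let c : ι → E →L[ℝ] ℝ := fun i => LinearMap.toContinuousLinearMap (b.coord i)
  have hφ := mdifferentiableAt_extChartAt (I := 𝓘(ℝ, E)) (x := y₀) hy
  have hcomp : ∀ i, HasMFDerivAt 𝓘(ℝ, E) 𝓘(ℝ, ℝ) (h i) y
      (((c i) ∘L fderiv ℝ (chartRep y₀ ξ) (extChartAt 𝓘(ℝ, E) y₀ y)) ∘L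
        mfderiv 𝓘(ℝ, E) 𝓘(ℝ, E) (extChartAt 𝓘(ℝ, E) y₀) y) := fun i =>
    HasMFDerivAt.comp (g := fun u => c i (chartRep y₀ ξ u)) y
      ((c i).hasFDerivAt.comp _ hξ.hasFDerivAt).hasMFDerivAt hφ.hasMFDerivAt
  -- The expansion in the frame holds only near `y`, which suffices because `cov` is local.
  have heq : ∀ᶠ x in 𝓝 y, ξ x = (∑ i, h i • g i) x := by
    filter_upwards [hg, (chartAt E y₀).open_source.mem_nhds hy] with x hx hxs
    have hs := e.eq_sum_localFrameCoeff_smul (I := 𝓘(ℝ, E)) (b := b) (s := ξ) (x' := x) hxs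
    rw [hs, Finset.sum_apply]
    refine Finset.sum_congr rfl fun i _ => ?_
    rw [Pi.smul_apply', hx i, e.localFrameCoeff_eq_coeff (I := 𝓘(ℝ, E)) (b := b) hxs]
    congr 1
    simp only [h, chartRep]
    rw [(extChartAt 𝓘(ℝ, E) y₀).left_inv (by rwa [extChartAt_source])]
    rfl
  obtain ⟨hd, hcov⟩ := cov_sum_smul cov Finset.univ hgd (fun i => (hcomp i).mdifferentiableAt)
  have hcovξ : cov ξ y = cov (∑ i, h i • g i) y :=
    cov.isCovariantDerivativeOn.congr_of_eventuallyEq (isDifferentiableAt_of_chartRep hy hξ) hd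
      univ_mem heq
  -- The trivialization of `TM` is the derivative of the chart, so `e.symmL ℝ y w` is the tangent
  -- vector with coordinates `w`.
  have hLS : mfderiv 𝓘(ℝ, E) 𝓘(ℝ, E) (extChartAt 𝓘(ℝ, E) y₀) y (e.symmL ℝ y w) = w := by
    rw [← TangentBundle.continuousLinearMapAt_trivializationAt hy]
    exact e.continuousLinearMapAt_symmL hye w
  have hgy : ∀ i, e.continuousLinearMapAt ℝ y (g i y) = b i := by
    intro i
    rw [hg.self_of_nhds i, e.localFrame_apply_of_mem_baseSet b hye]
    simpa [Bundle.Trivialization.basisAt, e.coe_linearMapAt_of_mem hye] using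
      congrArg Prod.snd (e.apply_mk_symm hye (b i))
  have hmv : ∀ i, mvfderiv 𝓘(ℝ, E) (h i) y (e.symmL ℝ y w) =
      b.coord i (fderiv ℝ (chartRep y₀ ξ) (extChartAt 𝓘(ℝ, E) y₀ y) w) := by
    intro i
    have : mvfderiv 𝓘(ℝ, E) (h i) y (e.symmL ℝ y w) =
      c i (fderiv ℝ (chartRep y₀ ξ) (extChartAt 𝓘(ℝ, E) y₀ y)
        (mfderiv 𝓘(ℝ, E) 𝓘(ℝ, E) (extChartAt 𝓘(ℝ, E) y₀) y (e.symmL ℝ y w))) := by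
      unfold mvfderiv
      rw [(hcomp i).mfderiv]
      rfl
    rw [this, hLS]
    rfl
  rw [hcovξ, hcov, sum_apply, map_sum, ← Finset.sum_sub_distrib]
  conv_lhs => rw [← b.sum_repr (fderiv ℝ (chartRep y₀ ξ) (extChartAt 𝓘(ℝ, E) y₀ y) w)]
  refine Finset.sum_congr rfl fun i _ => ?_
  rw [add_apply, map_add, smul_apply,
    ContinuousLinearMap.smulRight_apply, map_smul, map_smul, hgy i, hmv i]
  change _ = (b.coord i _) • _ + _ - (b.coord i _) • _
  rw [add_sub_cancel_left]
  rfl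

end CovariantDerivative

/-! ### From the seminorm to chart bounds. -/

section ChartEstimate

variable {E : Type*} [NormedAddCommGroup E] [NormedSpace ℝ E]
  {M : Type*} [TopologicalSpace M] [ChartedSpace E M] [IsManifold 𝓘(ℝ, E) ∞ M]
  [RiemannianBundle (fun x : M => TangentSpace 𝓘(ℝ, E) x)]
  (cov : CovariantDerivative 𝓘(ℝ, E) E (TangentSpace 𝓘(ℝ, E) : M → Type _))

theorem enorm_le_lipSeminorm {K : Set M} {y : M} (hy : y ∈ K)
    (ξ : Π x : M, TangentSpace 𝓘(ℝ, E) x) : ‖ξ y‖ₑ ≤ lipSeminorm cov K ξ :=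
  (le_iSup₂ (f := fun x (_ : x ∈ K) => ‖ξ x‖ₑ) y hy).trans (le_max_right _ _)

/-- Every neighbourhood competing in the infimum that defines `dil` at `y` contains `y` itself. -/
theorem enorm_cov_le_lipSeminorm {K : Set M} {y : M} (hy : y ∈ K)
    {ξ : Π x : M, TangentSpace 𝓘(ℝ, E) x} (hξ : IsDifferentiableAt ξ y)
    {v : TangentSpace 𝓘(ℝ, E) y} (hv : ‖v‖ = 1) : ‖cov ξ y v‖ₑ ≤ lipSeminorm cov K ξ := by
  refine le_trans ?_ ((le_iSup₂ (f := fun x (_ : x ∈ K) => dil cov ξ x) y hy).trans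
    (le_max_left _ _))
  refine le_iInf₂ fun U hU => le_iInf fun _ => ?_
  have hyU : y ∈ closure U := subset_closure (mem_of_mem_nhds hU)
  unfold supCovDeriv
  refine le_iSup_of_le y (le_iSup_of_le hyU (le_iSup_of_le hξ (le_iSup_of_le v
    (le_iSup_of_le hv le_rfl))))

theorem norm_cov_le_mul {K : Set M} {y : M} (hy : y ∈ K)
    {ξ : Π x : M, TangentSpace 𝓘(ℝ, E) x} (hξ : IsDifferentiableAt ξ y)
    (hfin : lipSeminorm cov K ξ ≠ ⊤) (v : TangentSpace 𝓘(ℝ, E) y) :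
    ‖cov ξ y v‖ ≤ (lipSeminorm cov K ξ).toReal * ‖v‖ := by
  rcases eq_or_ne v 0 with rfl | hv
  · simp
  have hv' : 0 < ‖v‖ := norm_pos_iff.2 hv
  have h1 : ‖(‖v‖⁻¹ • v)‖ = 1 := by
    rw [norm_smul, norm_inv, norm_norm, inv_mul_cancel₀ hv'.ne']
  have h2 := enorm_cov_le_lipSeminorm cov hy hξ h1
  have h3 : ‖cov ξ y (‖v‖⁻¹ • v)‖ ≤ (lipSeminorm cov K ξ).toReal := by
    rw [← toReal_enorm]
    exact ENNReal.toReal_mono hfin h2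
  rw [map_smul, norm_smul, norm_inv, norm_norm] at h3
  rwa [inv_mul_le_iff₀ hv', mul_comm] at h3

variable [FiniteDimensional ℝ E] [T2Space M]
  [IsContMDiffRiemannianBundle 𝓘(ℝ, E) ∞ E (fun x : M => TangentSpace 𝓘(ℝ, E) x)]
  [CovariantDerivative.ContMDiffCovariantDerivative cov ∞]

/-- In a chart around any point, the seminorm `lipSeminorm` controls the sup-norm and the Lipschitz
constant of the representative of a locally Lipschitz vector field. -/
theorem exists_chart_estimate (y₀ : M) :
    ∃ r > 0, ∃ C : NNReal, 0 < C ∧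
      Metric.closedBall (extChartAt 𝓘(ℝ, E) y₀ y₀) (2 * r) ⊆ (extChartAt 𝓘(ℝ, E) y₀).target ∧
      ∀ ξ : Π x : M, TangentSpace 𝓘(ℝ, E) x, IsLocallyLipschitz ξ →
        (∀ u ∈ Metric.closedBall (extChartAt 𝓘(ℝ, E) y₀ y₀) r, ‖chartRep y₀ ξ u‖ₑ ≤
          C * lipSeminorm cov ((extChartAt 𝓘(ℝ, E) y₀).symm ''
            Metric.closedBall (extChartAt 𝓘(ℝ, E) y₀ y₀) r) ξ) ∧
        (∀ u ∈ Metric.closedBall (extChartAt 𝓘(ℝ, E) y₀ y₀) r,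
          ∀ v ∈ Metric.closedBall (extChartAt 𝓘(ℝ, E) y₀ y₀) r,
            ‖chartRep y₀ ξ u - chartRep y₀ ξ v‖ₑ ≤
              C * lipSeminorm cov ((extChartAt 𝓘(ℝ, E) y₀).symm ''
                Metric.closedBall (extChartAt 𝓘(ℝ, E) y₀ y₀) r) ξ * ‖u - v‖ₑ) := by
  have : IsContinuousRiemannianBundle E (fun x : M => TangentSpace 𝓘(ℝ, E) x) := by
    obtain ⟨g, hg, hin⟩ := IsContMDiffRiemannianBundle.exists_contMDiff (IB := 𝓘(ℝ, E)) (n := ∞)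
      (F := E) (E := fun x : M => TangentSpace 𝓘(ℝ, E) x)
    exact ⟨g, hg.continuous, hin⟩
  let e := trivializationAt E (TangentSpace 𝓘(ℝ, E) : M → Type _) y₀
  let b := Module.finBasis ℝ E
  let φ := extChartAt 𝓘(ℝ, E) y₀
  obtain ⟨g, hgs, hg⟩ := exists_contMDiff_eventuallyEq_localFrame (M := M) b y₀
  obtain ⟨C₁, hC₁, h1⟩ :=
    eventually_norm_trivializationAt_lt E (fun x : M => TangentSpace 𝓘(ℝ, E) x) y₀
  obtain ⟨C₂, hC₂, h2⟩ :=
    eventually_norm_symmL_trivializationAt_lt E (fun x : M => TangentSpace 𝓘(ℝ, E) x) y₀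
  -- The connection coefficients are continuous in coordinates, hence bounded near `y₀`.
  have h3 : ∃ C₃ > 0, ∀ᶠ y in 𝓝 y₀, ∀ i, ∀ w : E,
      ‖e.continuousLinearMapAt ℝ y (cov (g i) y (e.symmL ℝ y w))‖ ≤ C₃ * ‖w‖ := by
    have hi : ∀ i, ∃ c > 0, ∀ᶠ y in 𝓝 y₀, ∀ w : E,
        ‖e.continuousLinearMapAt ℝ y (cov (g i) y (e.symmL ℝ y w))‖ ≤ c * ‖w‖ := by
      intro i
      have hsm := (CovariantDerivative.ContMDiffCovariantDerivative.contMDiff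
        (cov := cov) (k := ∞)).contMDiff (σ := g i) ((hgs i).contMDiffOn)
      have hc := ((contMDiffAt_hom_bundle _).1 (hsm.contMDiffAt (x := y₀) univ_mem)).2.continuousAt
      let A : M → E →L[ℝ] E := fun y => ContinuousLinearMap.inCoordinates E
        (TangentSpace 𝓘(ℝ, E) : M → Type _) E (TangentSpace 𝓘(ℝ, E) : M → Type _)
        y₀ y y₀ y (cov (g i) y)
      have hA : ContinuousAt A y₀ := hc
      refine ⟨‖A y₀‖ + 1, by positivity, ?_⟩
      filter_upwards [hA.norm.eventually_lt continuousAt_const (lt_add_one ‖A y₀‖)] with y hy w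
      exact ((A y).le_opNorm w).trans (by gcongr)
    choose c hcpos hc using hi
    refine ⟨∑ i, c i + 1, by
      have : 0 ≤ ∑ i, c i := Finset.sum_nonneg fun i _ => (hcpos i).le
      linarith, ?_⟩
    filter_upwards [eventually_all.2 hc] with y hy i w
    refine (hy i w).trans ?_
    gcongr
    exact (Finset.single_le_sum (fun j _ => (hcpos j).le) (Finset.mem_univ i)).trans
      (lt_add_one _).le
  obtain ⟨C₃, hC₃, h3⟩ := h3
  have hgood : ∀ᶠ y in 𝓝 y₀, y ∈ (chartAt E y₀).source ∧
      ‖e.continuousLinearMapAt ℝ y‖ < C₁ ∧ ‖e.symmL ℝ y‖ < C₂ ∧ (∀ i, ∀ w : E,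
      ‖e.continuousLinearMapAt ℝ y (cov (g i) y (e.symmL ℝ y w))‖ ≤ C₃ * ‖w‖) ∧
      ∀ᶠ x in 𝓝 y, ∀ i, g i x = e.localFrame b i x := by
    filter_upwards [chart_source_mem_nhds E y₀, h1, h2, h3, hg.eventually_nhds]
      with y a1 a2 a3 a4 a5 using ⟨a1, a2, a3, a4, a5⟩
  have hpull : ∀ᶠ u in 𝓝 (φ y₀), u ∈ φ.target ∧ (φ.symm u) ∈ {y | y ∈ (chartAt E y₀).source ∧
      ‖e.continuousLinearMapAt ℝ y‖ < C₁ ∧ ‖e.symmL ℝ y‖ < C₂ ∧ (∀ i, ∀ w : E,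
      ‖e.continuousLinearMapAt ℝ y (cov (g i) y (e.symmL ℝ y w))‖ ≤ C₃ * ‖w‖) ∧
      ∀ᶠ x in 𝓝 y, ∀ i, g i x = e.localFrame b i x} := by
    refine Filter.Eventually.and (extChartAt_target_mem_nhds (I := 𝓘(ℝ, E)) y₀) ?_
    have hcs : Tendsto φ.symm (𝓝 (φ y₀)) (𝓝 y₀) := by
      have := continuousAt_extChartAt_symm (I := 𝓘(ℝ, E)) y₀
      rwa [ContinuousAt, extChartAt_to_inv] at this
    exact hcs.eventually hgood
  obtain ⟨R, hR, hballR⟩ := Metric.nhds_basis_closedBall.mem_iff.1 hpull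
  obtain ⟨r, rfl⟩ : ∃ r, R = 2 * r := ⟨R / 2, by ring⟩
  have hr : 0 < r := by linarith
  have hball := (Metric.closedBall_subset_closedBall (by linarith : r ≤ 2 * r)).trans hballR
  let D : ℝ := ∑ i, ‖LinearMap.toContinuousLinearMap (b.coord i)‖
  have hD : 0 ≤ D := Finset.sum_nonneg fun i _ => norm_nonneg _
  -- The first term comes from the covariant derivative, the second from the connection
  -- coefficients, and the last from the size of the representative.
  let C : NNReal := ⟨C₁ * C₂ + D * C₁ * C₃ + C₁, by positivity⟩
  refine ⟨r, hr, C, ?_, fun u hu => (hballR hu).1, fun ξ hξ => ?_⟩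
  · rw [← NNReal.coe_pos]
    change 0 < C₁ * C₂ + D * C₁ * C₃ + C₁
    positivity
  set K := φ.symm '' Metric.closedBall (φ y₀) r with hK
  set N := lipSeminorm cov K ξ with hN
  have hCpos : (C : ℝ≥0∞) ≠ 0 := by
    simp only [ne_eq, ENNReal.coe_eq_zero, ← NNReal.coe_eq_zero]
    change ¬ (C₁ * C₂ + D * C₁ * C₃ + C₁ = 0)
    positivity
  -- For an infinite seminorm only `u = v` needs care, since `⊤ * 0 = 0`.
  rcases eq_or_ne N ⊤ with htop | hfin
  · rw [htop, ENNReal.mul_top hCpos]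
    refine ⟨fun u _ => le_top, fun u _ v _ => ?_⟩
    rcases eq_or_ne u v with rfl | huv
    · simp
    · rw [ENNReal.top_mul (by simpa [sub_eq_zero] using huv)]
      exact le_top
  set n := N.toReal with hn
  have hn0 : 0 ≤ n := ENNReal.toReal_nonneg
  have hCN : (C : ℝ≥0∞) * N = ENNReal.ofReal (C * n) := by
    rw [ENNReal.ofReal_mul C.coe_nonneg, ENNReal.ofReal_coe_nnreal, hn, ENNReal.ofReal_toReal hfin]
  have hbound : ∀ u ∈ Metric.closedBall (φ y₀) r, ‖chartRep y₀ ξ u‖ ≤ C₁ * n := by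
    intro u hu
    obtain ⟨hut, hus, hu1, -⟩ := hball hu
    rw [chartRep_eq y₀ ξ hut]
    have h4 : ‖ξ (φ.symm u)‖ ≤ n := by
      rw [← toReal_enorm]
      exact ENNReal.toReal_mono hfin (enorm_le_lipSeminorm cov (mem_image_of_mem _ hu) ξ)
    exact ((e.continuousLinearMapAt ℝ (φ.symm u)).le_opNorm _).trans (by gcongr)
  have hlip : ∀ u ∈ Metric.closedBall (φ y₀) r, ∀ v ∈ Metric.closedBall (φ y₀) r,
      ‖chartRep y₀ ξ u - chartRep y₀ ξ v‖ ≤ (C₁ * C₂ + D * C₁ * C₃) * n * ‖u - v‖ := by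
    -- Compactness gives some Lipschitz constant, enough for Rademacher; the mean value inequality
    -- then replaces it by the derivative bound.
    have hll : LocallyLipschitzOn (Metric.closedBall (φ y₀) r) (chartRep y₀ ξ) := by
      intro u hu
      obtain ⟨c, s, hs, h⟩ := hξ.lipschitzNear_chartRep y₀ (hball hu).1
      exact ⟨c, s, nhdsWithin_le_nhds hs, h⟩
    obtain ⟨c, hc⟩ := hll.exists_lipschitzOnWith_of_compact (isCompact_closedBall _ _)
    intro u hu v hv
    refine norm_sub_le_of_norm_fderiv_le hr hc (fun x hx hdiff => ?_) hu hv
    have hx' := Metric.ball_subset_closedBall hx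
    obtain ⟨hxt, hxs, hx1, hx2, hx3, hx4⟩ := hball hx'
    have hφx : φ (φ.symm x) = x := φ.right_inv hxt
    have hdiff' : DifferentiableAt ℝ (chartRep y₀ ξ) (φ (φ.symm x)) := by rwa [hφx]
    refine ContinuousLinearMap.opNorm_le_bound _ (by positivity) fun w => ?_
    have hform := fderiv_chartRep_apply cov b hxs
      (fun i => ((hgs i) (φ.symm x)).mdifferentiableAt (by simp)) hx4 hdiff' w
    have hd := isDifferentiableAt_of_chartRep hxs hdiff'
    change fderiv ℝ (chartRep y₀ ξ) (φ (φ.symm x)) w = _ at hform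
    rw [hφx] at hform
    have t1 : ‖e.continuousLinearMapAt ℝ (φ.symm x) (cov ξ (φ.symm x) (e.symmL ℝ (φ.symm x) w))‖
        ≤ C₁ * (n * (C₂ * ‖w‖)) := by
      refine ((e.continuousLinearMapAt ℝ (φ.symm x)).le_opNorm _).trans ?_
      gcongr
      refine (norm_cov_le_mul cov (mem_image_of_mem _ hx') hd hfin _).trans ?_
      gcongr
      exact ((e.symmL ℝ (φ.symm x)).le_opNorm w).trans (by gcongr)
    have t2 : ‖∑ i, b.repr (chartRep y₀ ξ x) i • e.continuousLinearMapAt ℝ (φ.symm x)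
        (cov (g i) (φ.symm x) (e.symmL ℝ (φ.symm x) w))‖ ≤ D * (C₁ * n) * (C₃ * ‖w‖) := by
      refine (norm_sum_le _ _).trans ?_
      rw [Finset.sum_mul, Finset.sum_mul]
      refine Finset.sum_le_sum fun i _ => ?_
      rw [norm_smul]
      gcongr
      · exact ((LinearMap.toContinuousLinearMap (b.coord i)).le_opNorm _).trans
          (by gcongr; exact hbound x hx')
      · exact hx3 i w
    rw [hform]
    refine (norm_sub_le _ _).trans ((add_le_add t1 t2).trans (le_of_eq ?_))
    ring
  constructor
  · intro u hu
    rw [hCN, ← ofReal_norm]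
    refine ENNReal.ofReal_le_ofReal ((hbound u hu).trans ?_)
    gcongr
    change C₁ ≤ C₁ * C₂ + D * C₁ * C₃ + C₁
    have : 0 ≤ C₁ * C₂ + D * C₁ * C₃ := by positivity
    linarith
  · intro u hu v hv
    rw [hCN, ← ofReal_norm, ← ofReal_norm, ← ENNReal.ofReal_mul (by positivity)]
    refine ENNReal.ofReal_le_ofReal ((hlip u hu v hv).trans ?_)
    gcongr
    change C₁ * C₂ + D * C₁ * C₃ ≤ C₁ * C₂ + D * C₁ * C₃ + C₁
    linarith

end ChartEstimate

/-- On each piece `f` is the primitive of its integrable derivative, hence so on the whole interval,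
and primitives are absolutely continuous. -/
theorem absolutelyContinuousOnInterval_trans {f : ℝ → ℝ} {a b c : ℝ} (hab : a ≤ b) (hbc : b ≤ c)
    (h₁ : AbsolutelyContinuousOnInterval f a b) (h₂ : AbsolutelyContinuousOnInterval f b c) :
    AbsolutelyContinuousOnInterval f a c := by
  have i₁ := h₁.intervalIntegrable_deriv
  have i₂ := h₂.intervalIntegrable_deriv
  have h_int : ∀ t ∈ uIcc a c, f t - f a = ∫ r in a..t, deriv f r := by
    intro t ht
    rw [uIcc_of_le (hab.trans hbc)] at ht
    rcases le_total t b with htb | hbt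
    · have : uIcc a t ⊆ uIcc a b := by
        rw [uIcc_of_le ht.1, uIcc_of_le hab]; exact Icc_subset_Icc_right htb
      exact ((h₁.mono this).integral_deriv_eq_sub).symm
    · have hs : uIcc b t ⊆ uIcc b c := by
        rw [uIcc_of_le hbt, uIcc_of_le hbc]; exact Icc_subset_Icc_right ht.2
      rw [← intervalIntegral.integral_add_adjacent_intervals i₁ (i₂.mono_set hs),
        h₁.integral_deriv_eq_sub, (h₂.mono hs).integral_deriv_eq_sub]
      ring
  refine absolutelyContinuousOnInterval_of_dist_le
    ((i₁.trans i₂).absolutelyContinuousOnInterval_intervalIntegral left_mem_uIcc)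
    fun s hs t ht => ?_
  rw [← h_int s hs, ← h_int t ht, dist_sub_right]

/-! ### Restriction, concatenation and continuity of integral curves. -/

section Curves

variable {E : Type*} [NormedAddCommGroup E] [NormedSpace ℝ E]
  {M : Type*} [TopologicalSpace M] [ChartedSpace E M]
  {T J J' : Set ℝ} {ξ : ℝ → Π x : M, TangentSpace 𝓘(ℝ, E) x} {γ γ₁ γ₂ : ℝ → M} {a b c : ℝ}

theorem IsIntegralCurve.mono (hγ : IsIntegralCurve T ξ J γ) (hJ' : J'.OrdConnected)
    (hsub : J' ⊆ J) : IsIntegralCurve T ξ J' γ where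
  ordConnected := hJ'
  subset := hsub.trans hγ.subset
  locallyAC f hf a ha b hb := hγ.locallyAC f hf a (hsub ha) b (hsub hb)
  hasDeriv := by
    filter_upwards [ae_restrict_of_ae_restrict_of_subset hsub hγ.hasDeriv] with t ht
    exact ht.mono hsub

theorem IsIntegralCurve.ae_hasMFDerivAt (hγ : IsIntegralCurve T ξ (Icc a b) γ) :
    ∀ᵐ t, t ∈ Ioo a b →
      HasMFDerivAt 𝓘(ℝ, ℝ) 𝓘(ℝ, E) γ t ((1 : ℝ →L[ℝ] ℝ).smulRight (ξ t (γ t))) := by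
  have h := (ae_restrict_iff' measurableSet_Icc).1 hγ.hasDeriv
  filter_upwards [h] with t ht hmem
  exact (ht (Ioo_subset_Icc_self hmem)).hasMFDerivAt (Icc_mem_nhds hmem.1 hmem.2)

theorem ae_restrict_Icc_of_Ioo {p : ℝ → Prop} (h : ∀ᵐ t, t ∈ Ioo a b → p t) :
    ∀ᵐ t ∂(volume.restrict (Icc a b)), p t := by
  rw [← restrict_Ioo_eq_restrict_Icc]
  exact (ae_restrict_iff' measurableSet_Ioo).2 h

theorem isLocallyAC_Icc (hab : a ≤ b) (h : ∀ f : M → ℝ, ContMDiff 𝓘(ℝ, E) 𝓘(ℝ, ℝ) ∞ f →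
    AbsolutelyContinuousOnInterval (f ∘ γ) a b) : IsLocallyAC E γ (Icc a b) :=
  fun f hf s hs t ht => (h f hf).mono (by
    rw [uIcc_of_le hab]; exact uIcc_subset_Icc_of_mem hs ht)

theorem IsIntegralCurve.trans (hab : a ≤ b) (hbc : b ≤ c) (hT : T.OrdConnected)
    (h₁ : IsIntegralCurve T ξ (Icc a b) γ₁) (h₂ : IsIntegralCurve T ξ (Icc b c) γ₂)
    (heq : γ₁ b = γ₂ b) :
    IsIntegralCurve T ξ (Icc a c) (fun t => if t ≤ b then γ₁ t else γ₂ t) where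
  ordConnected := ordConnected_Icc
  subset := hT.out (h₁.subset (left_mem_Icc.2 hab)) (h₂.subset (right_mem_Icc.2 hbc))
  locallyAC := by
    refine isLocallyAC_Icc (hab.trans hbc) fun f hf => ?_
    refine absolutelyContinuousOnInterval_trans hab hbc ?_ ?_
    · refine absolutelyContinuousOnInterval_of_dist_le (h₁.locallyAC f hf a (left_mem_Icc.2 hab) b
        (right_mem_Icc.2 hab)) fun s hs t ht => le_of_eq ?_
      rw [uIcc_of_le hab] at hs ht
      simp [hs.2, ht.2]
    · have key : ∀ s ∈ uIcc b c, (if s ≤ b then γ₁ s else γ₂ s) = γ₂ s := by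
        intro s hs
        rw [uIcc_of_le hbc] at hs
        split_ifs with h
        · rw [le_antisymm h hs.1, heq]
        · rfl
      refine absolutelyContinuousOnInterval_of_dist_le (h₂.locallyAC f hf b (left_mem_Icc.2 hbc) c
        (right_mem_Icc.2 hbc)) fun s hs t ht => le_of_eq ?_
      simp only [Function.comp_apply]
      rw [key s hs, key t ht]
  hasDeriv := by
    refine ae_restrict_Icc_of_Ioo ?_
    -- The junction time `b`, where the two velocities may differ, is a null set.
    filter_upwards [h₁.ae_hasMFDerivAt, h₂.ae_hasMFDerivAt, Measure.ae_ne volume b]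
      with t ht₁ ht₂ hne hmem
    rcases lt_or_gt_of_ne hne with hlt | hgt
    · have h := ht₁ ⟨hmem.1, hlt⟩
      have hev : (fun t => if t ≤ b then γ₁ t else γ₂ t) =ᶠ[𝓝 t] γ₁ := by
        filter_upwards [Iio_mem_nhds hlt] with s hs
        simp [(mem_Iio.1 hs).le]
      have hval : (if t ≤ b then γ₁ t else γ₂ t) = γ₁ t := if_pos hlt.le
      rw [hval]
      exact (h.congr_of_eventuallyEq hev).hasMFDerivWithinAt
    · have h := ht₂ ⟨hgt, hmem.2⟩
      have hev : (fun t => if t ≤ b then γ₁ t else γ₂ t) =ᶠ[𝓝 t] γ₂ := by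
        filter_upwards [Ioi_mem_nhds hgt] with s hs
        simp [not_le.2 (mem_Ioi.1 hs)]
      have hval : (if t ≤ b then γ₁ t else γ₂ t) = γ₂ t := if_neg (not_le.2 hgt)
      rw [hval]
      exact (h.congr_of_eventuallyEq hev).hasMFDerivWithinAt

variable [IsManifold 𝓘(ℝ, E) ∞ M] [FiniteDimensional ℝ E] [T2Space M]

/-- Absolute continuity is tested only against smooth functions. Continuity follows because supports
of bump functions form a neighbourhood basis. -/
theorem IsLocallyAC.continuousOn_uIcc (hγ : IsLocallyAC E γ J) (ha : a ∈ J) (hb : b ∈ J) :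
    ContinuousOn γ (uIcc a b) := by
  intro t ht U hU
  obtain ⟨ψ, -, hψ⟩ := (SmoothBumpFunction.nhds_basis_support (I := 𝓘(ℝ, E)) hU).mem_iff.1 hU
  have hc := (hγ ψ ψ.contMDiff a ha b hb).continuousOn t ht
  have h1 : ∀ᶠ s in 𝓝[uIcc a b] t, 0 < (ψ ∘ γ) s :=
    hc.eventually_const_lt (by simp)
  refine mem_map.2 ?_
  filter_upwards [h1] with s hs
  exact hψ hs.ne'

end Curves

/-! ### Integral curves and integral equations. -/

section ChartCurves

variable {E : Type*} [NormedAddCommGroup E] [NormedSpace ℝ E] [FiniteDimensional ℝ E]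
  {M : Type*} [TopologicalSpace M] [ChartedSpace E M] [IsManifold 𝓘(ℝ, E) ∞ M]
  {T : Set ℝ} {ξ : ℝ → Π x : M, TangentSpace 𝓘(ℝ, E) x} {γ : ℝ → M} {a b r : ℝ} {y₀ : M}

/-- An integral curve inside a chart solves the corresponding integral equation. -/
theorem IsIntegralCurve.integral_eq [T2Space M] (hr : 0 < r)
    (hball : Metric.closedBall (extChartAt 𝓘(ℝ, E) y₀ y₀) (2 * r) ⊆
      (extChartAt 𝓘(ℝ, E) y₀).target)
    (hγ : IsIntegralCurve T ξ (Icc a b) γ)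
    (hγs : ∀ t ∈ Icc a b, γ t ∈ (chartAt E y₀).source)
    (hγb : ∀ t ∈ Icc a b, extChartAt 𝓘(ℝ, E) y₀ (γ t) ∈
      Metric.closedBall (extChartAt 𝓘(ℝ, E) y₀ y₀) r)
    (h_int : IntegrableOn (fun t => chartRep y₀ (ξ t) (extChartAt 𝓘(ℝ, E) y₀ (γ t))) (Icc a b))
    {s t : ℝ} (hs : s ∈ Icc a b) (ht : t ∈ Icc a b) :
    extChartAt 𝓘(ℝ, E) y₀ (γ t) = extChartAt 𝓘(ℝ, E) y₀ (γ s) +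
      ∫ τ in s..t, chartRep y₀ (ξ τ) (extChartAt 𝓘(ℝ, E) y₀ (γ τ)) := by
  set φ := extChartAt 𝓘(ℝ, E) y₀ with hφ
  have hsub : uIcc s t ⊆ Icc a b := uIcc_subset_Icc_of_mem hs ht
  -- Multiplied by `ψ`, coordinate functions become smooth on all of `M` and are unchanged along
  -- `γ`. The radius `2 * r` leaves room for the cut-off.
  let ψ : SmoothBumpFunction 𝓘(ℝ, E) y₀ :=
    { rIn := r
      rOut := 2 * r
      rIn_pos := hr
      rIn_lt_rOut := by linarith
      closedBall_subset := inter_subset_left.trans hball }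
  have hψ : ∀ τ ∈ Icc a b, ψ (γ τ) = 1 := fun τ hτ =>
    ψ.one_of_dist_le (hγs τ hτ) (hγb τ hτ)
  have hder : ∀ᵐ τ, τ ∈ Ioo a b →
      HasDerivAt (fun τ => φ (γ τ)) (chartRep y₀ (ξ τ) (φ (γ τ))) τ := by
    filter_upwards [hγ.ae_hasMFDerivAt] with τ hτ hmem
    have hτ' := Ioo_subset_Icc_self hmem
    have h1 := (mdifferentiableAt_extChartAt (I := 𝓘(ℝ, E)) (hγs τ hτ')).hasMFDerivAt.comp τ
      (hτ hmem)
    let A : E →L[ℝ] E := mfderiv 𝓘(ℝ, E) 𝓘(ℝ, E) (extChartAt 𝓘(ℝ, E) y₀) (γ τ)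
    let v : E := ξ τ (γ τ)
    have h2 : HasFDerivAt (fun τ => φ (γ τ)) ((1 : ℝ →L[ℝ] ℝ).smulRight (A v)) τ := by
      refine h1.hasFDerivAt.congr_fderiv (ContinuousLinearMap.ext fun q : ℝ => ?_)
      exact map_smul A q v
    have h3 : φ.symm (φ (γ τ)) = γ τ := φ.left_inv (by rw [hφ, extChartAt_source]; exact hγs τ hτ')
    have h4 : chartRep y₀ (ξ τ) (φ (γ τ)) = A v := by
      change _ = mfderiv 𝓘(ℝ, E) 𝓘(ℝ, E) (extChartAt 𝓘(ℝ, E) y₀) (γ τ) (ξ τ (γ τ))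
      rw [← TangentBundle.continuousLinearMapAt_trivializationAt (hγs τ hτ'),
        chartRep_eq y₀ (ξ τ) (φ.map_source (by rw [hφ, extChartAt_source]; exact hγs τ hτ')),
        ← hφ, h3]
      rfl
    rw [h4]
    simpa using h2.hasDerivAt
  rw [← sub_eq_iff_eq_add']
  refine (SeparatingDual.eq_iff_forall_dual_eq (R := ℝ)).2 fun ℓ => ?_
  have hF : ContMDiff 𝓘(ℝ, E) 𝓘(ℝ, ℝ) ∞ (fun x => ψ x • ℓ (φ x)) :=
    ψ.contMDiff_smul (g := fun x => ℓ (φ x))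
      (ℓ.contDiff.contMDiff.comp_contMDiffOn (contMDiffOn_extChartAt (x := y₀)))
  have hac : AbsolutelyContinuousOnInterval (fun τ => ℓ (φ (γ τ))) s t := by
    refine absolutelyContinuousOnInterval_of_dist_le (hγ.locallyAC _ hF s hs t ht)
      fun τ hτ τ' hτ' => le_of_eq ?_
    simp [hψ τ (hsub hτ), hψ τ' (hsub hτ')]
  have hI := hac.integral_deriv_eq_sub
  rw [map_sub, ← hI, ← ContinuousLinearMap.intervalIntegral_comp_comm ℓ
    (h_int.mono_set hsub).intervalIntegrable]
  refine intervalIntegral.integral_congr_ae ?_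
  filter_upwards [hder, Measure.ae_ne volume a, Measure.ae_ne volume b] with τ h1 h2 h3 hmem
  have hτ := hsub (uIoc_subset_uIcc hmem)
  have := h1 ⟨lt_of_le_of_ne hτ.1 h2.symm, lt_of_le_of_ne hτ.2 h3⟩
  exact (ℓ.hasFDerivAt.comp_hasDerivAt τ this).deriv

/-- A solution of the integral equation in a chart defines an integral curve. -/
theorem isIntegralCurve_of_integral_eq
    (hball : Metric.closedBall (extChartAt 𝓘(ℝ, E) y₀ y₀) r ⊆ (extChartAt 𝓘(ℝ, E) y₀).target)
    (hT : Icc a b ⊆ T) {u : ℝ → E}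
    (hub : ∀ t ∈ Icc a b, u t ∈ Metric.closedBall (extChartAt 𝓘(ℝ, E) y₀ y₀) r)
    (h_int : IntegrableOn (fun t => chartRep y₀ (ξ t) (u t)) (Icc a b))
    {s : ℝ} (hs : s ∈ Icc a b) {x : E}
    (hu : ∀ t ∈ Icc a b, u t = x + ∫ τ in s..t, chartRep y₀ (ξ τ) (u τ)) :
    IsIntegralCurve T ξ (Icc a b) (fun t => (extChartAt 𝓘(ℝ, E) y₀).symm (u t)) := by
  have hab : a ≤ b := hs.1.trans hs.2
  set φ := extChartAt 𝓘(ℝ, E) y₀ with hφ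
  have hii : IntervalIntegrable (fun t => chartRep y₀ (ξ t) (u t)) volume a b := by
    refine IntegrableOn.intervalIntegrable ?_
    rwa [uIcc_of_le hab]
  refine ⟨ordConnected_Icc, hT, isLocallyAC_Icc hab fun f hf => ?_, ae_restrict_Icc_of_Ioo ?_⟩
  · have hsm : ContDiffOn ℝ ∞ (fun v => f (φ.symm v)) (Metric.closedBall (φ y₀) r) := by
      rw [← contMDiffOn_iff_contDiffOn]
      exact hf.comp_contMDiffOn ((contMDiffOn_extChartAt_symm y₀).mono hball)
    obtain ⟨C, hC⟩ := hsm.exists_lipschitzOnWith (by simp) (convex_closedBall _ _)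
      (isCompact_closedBall _ _)
    refine absolutelyContinuousOnInterval_comp_primitive (F := fun v => f (φ.symm v)) hii ?_ hC
      (by rwa [uIcc_of_le hab])
    rw [uIcc_of_le hab]
    intro s' hs' t' ht'
    have hi : ∀ {q}, q ∈ Icc a b →
        IntervalIntegrable (fun t => chartRep y₀ (ξ t) (u t)) volume s q := fun hq =>
      (h_int.mono_set (uIcc_subset_Icc_of_mem hs hq)).intervalIntegrable
    rw [hu s' hs', hu t' ht', ← intervalIntegral.integral_interval_sub_left (hi ht') (hi hs')]
    abel
  · filter_upwards [hii.ae_hasDerivAt_integral] with τ hτ hmem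
    rw [uIcc_of_le hab] at hτ
    have hτ' := Ioo_subset_Icc_self hmem
    have h1 : HasDerivAt u (chartRep y₀ (ξ τ) (u τ)) τ := by
      refine ((hτ hτ' s hs).const_add x).congr_of_eventuallyEq ?_
      filter_upwards [Icc_mem_nhds hmem.1 hmem.2] with q hq using hu q hq
    have hut : u τ ∈ φ.target := hball (hub τ hτ')
    have hys := extChartAt_symm_mem_source y₀ hut
    have h2 : MDifferentiableAt 𝓘(ℝ, E) 𝓘(ℝ, E) φ.symm (u τ) :=
      ((contMDiffOn_extChartAt_symm (n := ∞) y₀).contMDiffAt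
        ((isOpen_extChartAt_target y₀).mem_nhds hut)).mdifferentiableAt (by simp)
    let w : E := chartRep y₀ (ξ τ) (u τ)
    let A : E →L[ℝ] E := mfderiv 𝓘(ℝ, E) 𝓘(ℝ, E) φ.symm (u τ)
    have hu' : HasMFDerivAt 𝓘(ℝ, ℝ) 𝓘(ℝ, E) u τ ((1 : ℝ →L[ℝ] ℝ).smulRight w) :=
      (h1.hasFDerivAt.congr_fderiv (ContinuousLinearMap.ext fun _ => rfl)).hasMFDerivAt
    have h3 := h2.hasMFDerivAt.comp τ hu'
    -- The derivative of the inverse chart undoes the trivialization used in `chartRep`.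
    have h4 : A w = ξ τ (φ.symm (u τ)) := by
      have h5 := (trivializationAt E (TangentSpace 𝓘(ℝ, E) : M → Type _)
        y₀).symmL_continuousLinearMapAt (R := ℝ) hys (ξ τ (φ.symm (u τ)))
      rw [TangentBundle.symmL_trivializationAt hys, ← hφ, ← chartRep_eq y₀ (ξ τ) hut] at h5
      have h6 : φ (φ.symm (u τ)) = u τ := φ.right_inv hut
      rw [h6, modelWithCornersSelf_coe, range_id, mfderivWithin_univ] at h5
      exact h5
    refine h3.hasMFDerivWithinAt.congr_mfderiv (ContinuousLinearMap.ext fun q : ℝ => ?_)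
    have h7 : A (q • w) = q • A w := map_smul A q w
    rw [h4] at h7
    exact h7

end ChartCurves

/-- Absolute continuity of the integral. It supplies the time steps short enough for the Picard
contraction. -/
theorem exists_pos_setLIntegral_Icc_le {A B : ℝ} {g : ℝ → ℝ≥0∞} (hg : ∫⁻ t in Icc A B, g t < ⊤)
    {ε : ℝ≥0∞} (hε : ε ≠ 0) :
    ∃ δ > 0, ∀ a b, Icc a b ⊆ Icc A B → b - a < δ → ∫⁻ t in Icc a b, g t ≤ ε := by
  obtain ⟨δ, hδ, h⟩ := exists_pos_setLIntegral_lt_of_measure_lt hg.ne hε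
  obtain ⟨d, hd, hdδ⟩ := ENNReal.lt_iff_exists_nnreal_btwn.1 hδ
  refine ⟨d, by exact_mod_cast hd, fun a b hab hlt => ?_⟩
  have h1 := h (Icc a b) (by
    rw [Measure.restrict_apply measurableSet_Icc]
    refine (measure_mono inter_subset_left).trans_lt ?_
    rw [Real.volume_Icc]
    refine lt_of_le_of_lt ?_ hdδ
    rw [ENNReal.ofReal_le_iff_le_toReal (by simp)]
    simpa using hlt.le)
  rw [Measure.restrict_restrict measurableSet_Icc, inter_eq_self_of_subset_left hab] at h1
  exact h1.le

/-! ### Uniqueness of integral curves. -/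

section Local

variable {E : Type*} [NormedAddCommGroup E] [NormedSpace ℝ E]
  {M : Type*} [TopologicalSpace M] [ChartedSpace E M]
  {T : Set ℝ} {γ γ₁ γ₂ : ℝ → M} {A B : ℝ} {y₀ : M}

theorem isCompact_image_extChartAt_symm [FiniteDimensional ℝ E] {r : ℝ}
    (hball : Metric.closedBall (extChartAt 𝓘(ℝ, E) y₀ y₀) r ⊆ (extChartAt 𝓘(ℝ, E) y₀).target) :
    IsCompact ((extChartAt 𝓘(ℝ, E) y₀).symm ''
      Metric.closedBall (extChartAt 𝓘(ℝ, E) y₀ y₀) r) :=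
  (isCompact_closedBall _ _).image_of_continuousOn ((continuousOn_extChartAt_symm y₀).mono hball)

theorem eventually_mem_chart_ball {s : ℝ} {S : Set ℝ} (hγ : ContinuousWithinAt γ S s)
    {r : ℝ} (hr : 0 < r) (hs : γ s = y₀) :
    ∀ᶠ t in 𝓝[S] s, γ t ∈ (chartAt E y₀).source ∧
      extChartAt 𝓘(ℝ, E) y₀ (γ t) ∈ Metric.closedBall (extChartAt 𝓘(ℝ, E) y₀ y₀) r := by
  subst hs
  have h1 : ∀ᶠ x in 𝓝 (γ s), x ∈ (chartAt E (γ s)).source ∧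
      extChartAt 𝓘(ℝ, E) (γ s) x ∈ Metric.closedBall (extChartAt 𝓘(ℝ, E) (γ s) (γ s)) r :=
    Filter.Eventually.and (chart_source_mem_nhds E (γ s))
      ((continuousAt_extChartAt (I := 𝓘(ℝ, E)) (γ s)) (Metric.closedBall_mem_nhds _ hr))
  exact hγ.eventually h1

variable [FiniteDimensional ℝ E] [IsManifold 𝓘(ℝ, E) ∞ M]
  [RiemannianBundle (fun x : M => TangentSpace 𝓘(ℝ, E) x)]
  (cov : CovariantDerivative 𝓘(ℝ, E) E (TangentSpace 𝓘(ℝ, E) : M → Type _))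

/-- A locally integrably bounded vector field is a Carathéodory vector field in charts. -/
theorem isCaratheodory_chartRep {ξ : ℝ → Π x : M, TangentSpace 𝓘(ℝ, E) x}
    (hξ : IsLocIntegrablyBounded cov T ξ) {r : ℝ} {C : NNReal}
    (hball : Metric.closedBall (extChartAt 𝓘(ℝ, E) y₀ y₀) r ⊆ (extChartAt 𝓘(ℝ, E) y₀).target)
    {a b : ℝ} (hab : Icc a b ⊆ T)
    (hC : ∀ t ∈ Icc a b, ∀ u ∈ Metric.closedBall (extChartAt 𝓘(ℝ, E) y₀ y₀) r,
      ‖chartRep y₀ (ξ t) u‖ₑ ≤ C * lipSeminorm cov ((extChartAt 𝓘(ℝ, E) y₀).symm ''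
            Metric.closedBall (extChartAt 𝓘(ℝ, E) y₀ y₀) r) (ξ t))
    {ℓ : ℝ → ℝ≥0∞}
    (hℓ : ∀ t ∈ Icc a b, ∀ u ∈ Metric.closedBall (extChartAt 𝓘(ℝ, E) y₀ y₀) r,
      ∀ v ∈ Metric.closedBall (extChartAt 𝓘(ℝ, E) y₀ y₀) r,
        ‖chartRep y₀ (ξ t) u - chartRep y₀ (ξ t) v‖ₑ ≤ ℓ t * ‖u - v‖ₑ)
    (h_int : ∫⁻ t in Icc a b, ℓ t ≤ 2⁻¹) :
    IsCaratheodory (fun t => chartRep y₀ (ξ t))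
      (Metric.closedBall (extChartAt 𝓘(ℝ, E) y₀ y₀) r) a b where
  meas u hu := by
    have h := (hξ.meas ((extChartAt 𝓘(ℝ, E) y₀).symm u)).mono_measure
      (Measure.restrict_mono hab le_rfl)
    have h2 := ((trivializationAt E (TangentSpace 𝓘(ℝ, E) : M → Type _) y₀).continuousLinearMapAt
      ℝ ((extChartAt 𝓘(ℝ, E) y₀).symm u)).continuous.comp_aestronglyMeasurable h
    refine h2.congr (Eventually.of_forall fun t => ?_)
    exact (chartRep_eq y₀ (ξ t) (hball hu)).symm
  cont t ht u hu :=
    ((hξ.lip t (hab ht)).lipschitzNear_chartRep y₀ (hball hu)).continuousAt.continuousWithinAt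
  bound := by
    refine ⟨_, hC, ?_⟩
    rw [lintegral_const_mul' _ _ (by simp)]
    exact ENNReal.mul_lt_top (by simp)
      (hξ.integrable _ (isCompact_image_extChartAt_symm hball) _ isCompact_Icc hab).2
  lip := ⟨ℓ, hℓ, h_int⟩

variable [T2Space M]
  [IsContMDiffRiemannianBundle 𝓘(ℝ, E) ∞ E (fun x : M => TangentSpace 𝓘(ℝ, E) x)]
  [CovariantDerivative.ContMDiffCovariantDerivative cov ∞]

/-- Integral curves that agree at some time agree at nearby times. -/
theorem IsIntegralCurve.eventuallyEq {ξ : ℝ → Π x : M, TangentSpace 𝓘(ℝ, E) x}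
    (hξ : IsLocIntegrablyBounded cov T ξ) (h₁ : IsIntegralCurve T ξ (Icc A B) γ₁)
    (h₂ : IsIntegralCurve T ξ (Icc A B) γ₂) {s : ℝ} (hs : s ∈ Icc A B) (heq : γ₁ s = γ₂ s) :
    ∀ᶠ t in 𝓝[Icc A B] s, γ₁ t = γ₂ t := by
  have hAB : A ≤ B := hs.1.trans hs.2
  obtain ⟨r, hr, C, hC, hball2, hest⟩ := exists_chart_estimate cov (γ₁ s)
  have hball := (Metric.closedBall_subset_closedBall (by linarith : r ≤ 2 * r)).trans hball2
  have hcont : ∀ {γ : ℝ → M}, IsIntegralCurve T ξ (Icc A B) γ → ContinuousOn γ (Icc A B) := by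
    intro γ hγ
    have := hγ.locallyAC.continuousOn_uIcc (left_mem_Icc.2 hAB) (right_mem_Icc.2 hAB)
    rwa [uIcc_of_le hAB] at this
  have hKint := hξ.integrable _ (isCompact_image_extChartAt_symm hball) _ isCompact_Icc h₁.subset
  obtain ⟨δ, hδ, hsmall⟩ := exists_pos_setLIntegral_Icc_le (A := A) (B := B)
    (g := fun t => C * lipSeminorm cov ((extChartAt 𝓘(ℝ, E) (γ₁ s)).symm ''
            Metric.closedBall (extChartAt 𝓘(ℝ, E) (γ₁ s) (γ₁ s)) r) (ξ t)) (by
      rw [lintegral_const_mul' _ _ (by simp)]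
      exact ENNReal.mul_lt_top (by simp) hKint.2) (ε := 2⁻¹) (by simp)
  have hmem := (eventually_mem_chart_ball (E := E) (hcont h₁ s hs) hr rfl).and
    (eventually_mem_chart_ball (E := E) (hcont h₂ s hs) hr heq.symm)
  obtain ⟨η, hη, hηmem⟩ := Metric.mem_nhdsWithin_iff.1 hmem
  -- An interval of radius `d` has length at most `2 * δ / 3 < δ`, and it lies in the open ball of
  -- radius `η`.
  let d := min (δ / 3) (η / 2)
  have hd : 0 < d := by positivity
  have hd1 : d ≤ δ / 3 := min_le_left _ _
  have hd2 : d ≤ η / 2 := min_le_right _ _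
  let a := max A (s - d)
  let b := min B (s + d)
  have hsub : Icc a b ⊆ Icc A B := Icc_subset_Icc (le_max_left _ _) (min_le_left _ _)
  have hsab : s ∈ Icc a b := ⟨max_le hs.1 (by linarith), le_min hs.2 (by linarith)⟩
  have hlen : b - a < δ := by
    have h1 : s - d ≤ a := le_max_right _ _
    have h2 : b ≤ s + d := min_le_right _ _
    linarith
  have hgood : ∀ t ∈ Icc a b, _ := fun t ht => hηmem (show t ∈ Metric.ball s η ∩ Icc A B from by
    refine ⟨?_, hsub ht⟩
    have h1 : s - d ≤ a := le_max_right _ _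
    have h2 : b ≤ s + d := min_le_right _ _
    rw [Metric.mem_ball, Real.dist_eq, abs_lt]
    constructor <;> linarith [ht.1, ht.2])
  have hcar := isCaratheodory_chartRep cov hξ hball (hsub.trans h₁.subset)
    (fun t ht => (hest (ξ t) (hξ.lip t (h₁.subset (hsub ht)))).1)
    (fun t ht => (hest (ξ t) (hξ.lip t (h₁.subset (hsub ht)))).2) (hsmall a b hsub hlen)
  have hc1 : ∀ {γ : ℝ → M}, IsIntegralCurve T ξ (Icc A B) γ →
      (∀ t ∈ Icc a b, γ t ∈ (chartAt E (γ₁ s)).source) →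
      ContinuousOn (fun t => extChartAt 𝓘(ℝ, E) (γ₁ s) (γ t)) (Icc a b) := by
    intro γ hγ hsrc
    refine (continuousOn_extChartAt (I := 𝓘(ℝ, E)) (γ₁ s)).comp ((hcont hγ).mono hsub) ?_
    intro t ht
    rw [extChartAt_source]
    exact hsrc t ht
  have hs1 : ∀ t ∈ Icc a b, γ₁ t ∈ (chartAt E (γ₁ s)).source := fun t ht => (hgood t ht).1.1
  have hs2 : ∀ t ∈ Icc a b, γ₂ t ∈ (chartAt E (γ₁ s)).source := fun t ht => (hgood t ht).2.1
  have hb1 : ∀ t ∈ Icc a b, _ := fun t ht => (hgood t ht).1.2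
  have hb2 : ∀ t ∈ Icc a b, _ := fun t ht => (hgood t ht).2.2
  have hEq := hcar.eqOn_of_integral_eq (hc1 h₁ hs1) hb1 (hc1 h₂ hs2) hb2 hsab
    (x := extChartAt 𝓘(ℝ, E) (γ₁ s) (γ₁ s))
    (fun t ht => (h₁.mono ordConnected_Icc hsub).integral_eq hr hball2 hs1 hb1
      (hcar.integrableOn_comp (hc1 h₁ hs1) hb1) hsab ht)
    (fun t ht => by
      have := (h₂.mono ordConnected_Icc hsub).integral_eq hr hball2 hs2 hb2
        (hcar.integrableOn_comp (hc1 h₂ hs2) hb2) hsab ht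
      rwa [← heq] at this)
  have hnear : Icc a b ∈ 𝓝[Icc A B] s := by
    refine Metric.mem_nhdsWithin_iff.2 ⟨d, hd, fun t ht => ?_⟩
    have h1 := ht.1
    rw [Metric.mem_ball, Real.dist_eq, abs_lt] at h1
    exact ⟨max_le ht.2.1 (by linarith), le_min ht.2.2 (by linarith)⟩
  filter_upwards [hnear] with t ht
  refine (extChartAt 𝓘(ℝ, E) (γ₁ s)).injOn ?_ ?_ (hEq ht)
  · rw [extChartAt_source]; exact hs1 t ht
  · rw [extChartAt_source]; exact hs2 t ht

/-- Integral curves that agree at some time agree on their common domain. -/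
theorem IsIntegralCurve.eqOn_Icc {ξ : ℝ → Π x : M, TangentSpace 𝓘(ℝ, E) x}
    (hξ : IsLocIntegrablyBounded cov T ξ) (h₁ : IsIntegralCurve T ξ (Icc A B) γ₁)
    (h₂ : IsIntegralCurve T ξ (Icc A B) γ₂) {s : ℝ} (hs : s ∈ Icc A B) (heq : γ₁ s = γ₂ s) :
    EqOn γ₁ γ₂ (Icc A B) := by
  have hAB : A ≤ B := hs.1.trans hs.2
  have hcont : ∀ {γ : ℝ → M}, IsIntegralCurve T ξ (Icc A B) γ →
      Continuous fun t : Icc A B => γ t := by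
    intro γ hγ
    have := hγ.locallyAC.continuousOn_uIcc (left_mem_Icc.2 hAB) (right_mem_Icc.2 hAB)
    rw [uIcc_of_le hAB] at this
    exact continuousOn_iff_continuous_domRestrict.1 this
  -- The agreement set is closed since `M` is Hausdorff and open by local uniqueness; the interval
  -- is connected.
  have hclopen : IsClopen {t : Icc A B | γ₁ t = γ₂ t} := by
    refine ⟨isClosed_eq (hcont h₁) (hcont h₂), isOpen_iff_mem_nhds.2 fun t ht => ?_⟩
    rw [nhds_subtype_eq_comap_nhdsWithin]
    exact ⟨_, h₁.eventuallyEq cov hξ h₂ t.2 ht, fun _ h => h⟩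
  have : PreconnectedSpace (Icc A B) := Subtype.preconnectedSpace isPreconnected_Icc
  have huniv := hclopen.eq_univ ⟨⟨s, hs⟩, heq⟩
  intro t ht
  exact (huniv ▸ mem_univ (⟨t, ht⟩ : Icc A B) : (⟨t, ht⟩ : Icc A B) ∈ {t : Icc A B | γ₁ t = γ₂ t})

end Local

/-! ### Composing local flows. -/

section Steps

variable {E : Type*} [NormedAddCommGroup E] [NormedSpace ℝ E]
  {M : Type*} [TopologicalSpace M] [ChartedSpace E M]
  {T : Set ℝ} {ξ : ℝ → Π x : M, TangentSpace 𝓘(ℝ, E) x}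

/-- Concatenation of integral curves, in either direction of time. -/
theorem IsIntegralCurve.exists_concat {s₁ s₂ s₃ : ℝ} (hT : T.OrdConnected) {β₁ β₂ : ℝ → M}
    (hs : s₂ ∈ uIcc s₁ s₃) (h₁ : IsIntegralCurve T ξ (uIcc s₁ s₂) β₁)
    (h₂ : IsIntegralCurve T ξ (uIcc s₂ s₃) β₂) (heq : β₁ s₂ = β₂ s₂) :
    ∃ β : ℝ → M, IsIntegralCurve T ξ (uIcc s₁ s₃) β ∧ EqOn β β₁ (uIcc s₁ s₂) ∧
      EqOn β β₂ (uIcc s₂ s₃) := by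
  rcases mem_uIcc.1 hs with ⟨h12, h23⟩ | ⟨h32, h21⟩
  · rw [uIcc_of_le h12] at h₁ ⊢
    rw [uIcc_of_le h23] at h₂ ⊢
    rw [uIcc_of_le (h12.trans h23)]
    refine ⟨_, h₁.trans h12 h23 hT h₂ heq, fun t ht => if_pos ht.2, fun t ht => ?_⟩
    rcases ht.1.eq_or_lt with rfl | h
    · simpa using heq
    · exact if_neg h.not_ge
  · rw [uIcc_of_ge h21] at h₁ ⊢
    rw [uIcc_of_ge h32] at h₂ ⊢
    rw [uIcc_of_ge (h32.trans h21)]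
    refine ⟨_, h₂.trans h32 h21 hT h₁ heq.symm, fun t ht => ?_, fun t ht => if_pos ht.2⟩
    rcases ht.1.eq_or_lt with rfl | h
    · simpa using heq.symm
    · exact if_neg h.not_ge

variable {P : Type*} [TopologicalSpace P]

/-- The flow of `X` from time `s₁` to time `s₂` is defined near `(γ s₁, p₀)`, takes values near
`γ s₂`, and passes through a fixed compact set only. -/
def HasLocalFlow (T : Set ℝ) (X : P → ℝ → Π x : M, TangentSpace 𝓘(ℝ, E) x) (p₀ : P) (γ : ℝ → M)
    (s₁ s₂ : ℝ) : Prop :=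
  ∀ W ∈ 𝓝 (γ s₂), ∃ V ∈ 𝓝 (γ s₁), ∃ O ∈ 𝓝 p₀, ∃ C : Set M, IsCompact C ∧
    ∀ x ∈ V, ∀ p ∈ O, ∃ β : ℝ → M, IsIntegralCurve T (X p) (uIcc s₁ s₂) β ∧ β s₁ = x ∧
      β s₂ ∈ W ∧ ∀ t ∈ uIcc s₁ s₂, β t ∈ C

/-- The arbitrary target `W` in `HasLocalFlow` is what makes steps compose: the initial
neighbourhood demanded by the second step serves as target of the first. -/
theorem HasLocalFlow.trans {X : P → ℝ → Π x : M, TangentSpace 𝓘(ℝ, E) x} {p₀ : P} {γ : ℝ → M}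
    {s₁ s₂ s₃ : ℝ} (hT : T.OrdConnected) (hs : s₂ ∈ uIcc s₁ s₃)
    (h₁ : HasLocalFlow T X p₀ γ s₁ s₂) (h₂ : HasLocalFlow T X p₀ γ s₂ s₃) :
    HasLocalFlow T X p₀ γ s₁ s₃ := by
  intro W hW
  obtain ⟨V', hV', O', hO', C', hC', H'⟩ := h₂ W hW
  obtain ⟨V, hV, O, hO, C, hC, H⟩ := h₁ V' hV'
  refine ⟨V, hV, O ∩ O', inter_mem hO hO', C ∪ C', hC.union hC', fun x hx p hp => ?_⟩
  obtain ⟨β₁, hβ₁, hx₁, hy₁, hc₁⟩ := H x hx p hp.1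
  obtain ⟨β₂, hβ₂, hx₂, hy₂, hc₂⟩ := H' _ hy₁ p hp.2
  obtain ⟨β, hβ, he₁, he₂⟩ := hβ₁.exists_concat hT hs hβ₂ hx₂.symm
  refine ⟨β, hβ, by rw [he₁ left_mem_uIcc, hx₁], by rw [he₂ right_mem_uIcc]; exact hy₂,
    fun t ht => ?_⟩
  rcases uIcc_subset_uIcc_union_uIcc (b := s₂) ht with h | h
  · rw [he₁ h]; exact Or.inl (hc₁ t h)
  · rw [he₂ h]; exact Or.inr (hc₂ t h)

end Steps

/-! ### Existence of local flows along an integral curve. -/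

section LocalFlow

variable {E : Type*} [NormedAddCommGroup E] [NormedSpace ℝ E] [FiniteDimensional ℝ E]
  {M : Type*} [TopologicalSpace M] [ChartedSpace E M] [IsManifold 𝓘(ℝ, E) ∞ M]
  [RiemannianBundle (fun x : M => TangentSpace 𝓘(ℝ, E) x)]
  (cov : CovariantDerivative 𝓘(ℝ, E) E (TangentSpace 𝓘(ℝ, E) : M → Type _))
  [T2Space M] {P : Type*} [TopologicalSpace P]
  {T : Set ℝ} {X : P → ℝ → Π x : M, TangentSpace 𝓘(ℝ, E) x} {p₀ : P} {γ : ℝ → M}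

/-- Local flows exist along an integral curve that stays in a small chart ball. -/
theorem hasLocalFlow_of_chart (hX : IsParamLocIntegrablyBounded cov T X) {y₀ : M} {r : ℝ}
    {C : NNReal} (hr : 0 < r)
    (hball2 : Metric.closedBall (extChartAt 𝓘(ℝ, E) y₀ y₀) (2 * r) ⊆
      (extChartAt 𝓘(ℝ, E) y₀).target)
    (hest : ∀ ξ : Π x : M, TangentSpace 𝓘(ℝ, E) x, IsLocallyLipschitz ξ →
      (∀ u ∈ Metric.closedBall (extChartAt 𝓘(ℝ, E) y₀ y₀) r,
        ‖chartRep y₀ ξ u‖ₑ ≤ C * lipSeminorm cov ((extChartAt 𝓘(ℝ, E) y₀).symm ''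
          Metric.closedBall (extChartAt 𝓘(ℝ, E) y₀ y₀) r) ξ) ∧
      (∀ u ∈ Metric.closedBall (extChartAt 𝓘(ℝ, E) y₀ y₀) r,
        ∀ v ∈ Metric.closedBall (extChartAt 𝓘(ℝ, E) y₀ y₀) r,
          ‖chartRep y₀ ξ u - chartRep y₀ ξ v‖ₑ ≤ C * lipSeminorm cov
            ((extChartAt 𝓘(ℝ, E) y₀).symm '' Metric.closedBall (extChartAt 𝓘(ℝ, E) y₀ y₀) r) ξ *
              ‖u - v‖ₑ))
    {a b : ℝ} (hγ : IsIntegralCurve T (X p₀) (Icc a b) γ)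
    (hsrc : ∀ t ∈ Icc a b, γ t ∈ (chartAt E y₀).source)
    (hmem : ∀ t ∈ Icc a b, extChartAt 𝓘(ℝ, E) y₀ (γ t) ∈
      Metric.closedBall (extChartAt 𝓘(ℝ, E) y₀ y₀) (r / 2))
    (h_int : ∫⁻ t in Icc a b, C * lipSeminorm cov ((extChartAt 𝓘(ℝ, E) y₀).symm ''
      Metric.closedBall (extChartAt 𝓘(ℝ, E) y₀ y₀) r) (X p₀ t) ≤ 4⁻¹)
    {s₁ s₂ : ℝ} (hs₁ : s₁ ∈ Icc a b) (hs₂ : s₂ ∈ Icc a b) : HasLocalFlow T X p₀ γ s₁ s₂ := by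
  intro W hW
  have hab : a ≤ b := hs₁.1.trans hs₁.2
  have hball := (Metric.closedBall_subset_closedBall (by linarith : r ≤ 2 * r)).trans hball2
  set φ := extChartAt 𝓘(ℝ, E) y₀ with hφ
  set Bl := Metric.closedBall (φ y₀) r with hBl
  set K := φ.symm '' Bl with hKdef
  have hK : IsCompact K := isCompact_image_extChartAt_symm hball
  have hsrc' : ∀ t ∈ Icc a b, γ t ∈ φ.source := fun t ht => by
    rw [hφ, extChartAt_source]; exact hsrc t ht
  set c : ℝ → E := fun t => φ (γ t) with hc
  have hcB : ∀ t ∈ Icc a b, Metric.closedBall (c t) (r / 2) ⊆ Bl := fun t ht =>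
    Metric.closedBall_subset_closedBall' (by
      have := Metric.mem_closedBall.1 (hmem t ht); linarith)
  have hcmem : ∀ t ∈ Icc a b, c t ∈ Bl := fun t ht =>
    hcB t ht (Metric.mem_closedBall_self (by positivity))
  have hγc : ContinuousOn γ (Icc a b) := by
    have := hγ.locallyAC.continuousOn_uIcc (left_mem_Icc.2 hab) (right_mem_Icc.2 hab)
    rwa [uIcc_of_le hab] at this
  have hcc : ContinuousOn c (Icc a b) := (continuousOn_extChartAt y₀).comp hγc hsrc'
  -- A tube of radius `ρ` about `c` stays in the chart ball and ends in `W`.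
  obtain ⟨ρ, hρ, hρr, hρW⟩ : ∃ ρ > 0, ρ ≤ r / 2 ∧
      ∀ v ∈ Metric.closedBall (c s₂) ρ, φ.symm v ∈ W := by
    have hcont : ContinuousAt φ.symm (c s₂) :=
      continuousAt_extChartAt_symm' (hsrc' s₂ hs₂)
    have hW' : φ.symm ⁻¹' W ∈ 𝓝 (c s₂) := by
      apply hcont
      rw [hc]
      simpa only [φ.left_inv (hsrc' s₂ hs₂)] using hW
    obtain ⟨ρ, hρ, h⟩ := Metric.nhds_basis_closedBall.mem_iff.1 hW'
    exact ⟨min ρ (r / 2), by positivity, min_le_right _ _, fun v hv =>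
      h (Metric.closedBall_subset_closedBall (min_le_left _ _) hv)⟩
  -- The bound `4⁻¹` completes the Lipschitz budget of `X p` to `2⁻¹`; the bound `ρ / 4` controls
  -- the defect of `c`.
  have hε : 0 < min 4⁻¹ (ENNReal.ofReal (ρ / 4)) / (C : ℝ≥0∞) :=
    ENNReal.div_pos (lt_min (by simp) (by simpa using hρ)).ne' (by simp)
  obtain ⟨O, hO, hOε⟩ := hX.continuous_seminorm p₀ K hK (Icc a b) isCompact_Icc hγ.subset _ hε
  refine ⟨φ.source ∩ φ ⁻¹' Metric.closedBall (c s₁) (ρ / 4), ?_, O, hO, K, hK,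
    fun x hx p hp => ?_⟩
  · refine inter_mem ((isOpen_extChartAt_source (I := 𝓘(ℝ, E)) y₀).mem_nhds (hsrc' s₁ hs₁)) ?_
    exact (continuousAt_extChartAt' (hsrc' s₁ hs₁)) (Metric.closedBall_mem_nhds _ (by positivity))
  have hLI := hX.locIntegrablyBounded
  have hdiff : ∀ t ∈ Icc a b, IsLocallyLipschitz (X p t - X p₀ t) := fun t ht =>
    ((hLI p).lip t (hγ.subset ht)).sub ((hLI p₀).lip t (hγ.subset ht))
  have hdint : ∫⁻ t in Icc a b, C * lipSeminorm cov K (X p t - X p₀ t) ≤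
      min 4⁻¹ (ENNReal.ofReal (ρ / 4)) := by
    rw [lintegral_const_mul' _ _ (by simp), mul_comm]
    exact ENNReal.mul_le_of_le_div (hOε p hp).2.le
  -- Lipschitz bounds for `X p₀` and for the difference are added in the chart, so no subadditivity
  -- of `lipSeminorm` is needed.
  have hℓint : ∫⁻ t in Icc a b, (C * lipSeminorm cov K (X p₀ t) +
      C * lipSeminorm cov K (X p t - X p₀ t)) ≤ 2⁻¹ := by
    rw [lintegral_add_left' (((hLI p₀).integrable K hK _ isCompact_Icc hγ.subset).1.const_mul _)]
    refine (add_le_add h_int (hdint.trans (min_le_left _ _))).trans (le_of_eq ?_)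
    rw [← two_mul, show (4 : ℝ≥0∞) = 2 * 2 by norm_num, ENNReal.mul_inv (by simp) (by simp),
      ← mul_assoc, ENNReal.mul_inv_cancel (by simp) (by simp), one_mul]
  have hsplit : ∀ t ∈ Icc a b, ∀ u ∈ Bl, chartRep y₀ (X p t) u =
      chartRep y₀ (X p₀ t) u + chartRep y₀ (X p t - X p₀ t) u := fun t ht u hu => by
    rw [chartRep_sub y₀ _ _ (hball hu)]; abel
  have hcar := isCaratheodory_chartRep cov (hLI p) hball hγ.subset
    (fun t ht => (hest (X p t) ((hLI p).lip t (hγ.subset ht))).1)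
    (fun t ht u hu v hv => by
      rw [hsplit t ht u hu, hsplit t ht v hv, add_sub_add_comm, add_mul]
      refine (enorm_add_le _ _).trans (add_le_add ?_ ?_)
      · exact (hest (X p₀ t) ((hLI p₀).lip t (hγ.subset ht))).2 u hu v hv
      · exact (hest _ (hdiff t ht)).2 u hu v hv) hℓint
  have hcar₀ := isCaratheodory_chartRep cov (hLI p₀) hball hγ.subset
    (fun t ht => (hest (X p₀ t) ((hLI p₀).lip t (hγ.subset ht))).1)
    (fun t ht => (hest (X p₀ t) ((hLI p₀).lip t (hγ.subset ht))).2)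
    (h_int.trans (ENNReal.inv_le_inv.2 (by norm_num)))
  have hceq : ∀ t ∈ Icc a b, c t = c s₁ + ∫ τ in s₁..t, chartRep y₀ (X p₀ τ) (c τ) :=
    fun t ht => hγ.integral_eq hr hball2 hsrc hcmem (hcar₀.integrableOn_comp hcc hcmem) hs₁ ht
  have hpert : ∀ t ∈ Icc a b, ‖(∫ τ in s₁..t, chartRep y₀ (X p τ) (c τ)) -
      ∫ τ in s₁..t, chartRep y₀ (X p₀ τ) (c τ)‖ ≤ ρ / 4 := by
    intro t ht
    rw [← intervalIntegral.integral_sub (hcar.intervalIntegrable_comp hcc hcmem hs₁ ht)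
      (hcar₀.intervalIntegrable_comp hcc hcmem hs₁ ht)]
    have hsub : uIoc s₁ t ⊆ Icc a b := uIoc_subset_uIcc.trans (uIcc_subset_Icc_of_mem hs₁ ht)
    rw [intervalIntegral.norm_intervalIntegral_eq]
    refine (ENNReal.ofReal_le_ofReal_iff (by positivity)).1 ?_
    rw [ofReal_norm]
    refine (enorm_integral_le_lintegral_enorm _).trans ?_
    refine le_trans ?_ (hdint.trans (min_le_right _ _))
    refine le_trans (setLIntegral_mono' measurableSet_uIoc fun τ hτ => ?_)
      (lintegral_mono_set hsub)
    rw [hsplit τ (hsub hτ) _ (hcmem τ (hsub hτ)), add_sub_cancel_left]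
    exact (hest _ (hdiff τ (hsub hτ))).1 _ (hcmem τ (hsub hτ))
  -- The admissible defect `ρ / 2` is split equally between the initial displacement and the
  -- perturbation of the field.
  obtain ⟨u, huc, hu⟩ := hcar.exists_solution_near (x := φ x) hcc hρ.le
    (fun t ht => (Metric.closedBall_subset_closedBall hρr).trans (hcB t ht)) hs₁ (fun t ht => by
      have h1 := hpert t ht
      have h2 : ‖φ x - c s₁‖ ≤ ρ / 4 := by
        rw [← dist_eq_norm]; exact Metric.mem_closedBall.1 hx.2
      rw [hceq t ht]
      have h3 : φ x + (∫ τ in s₁..t, chartRep y₀ (X p τ) (c τ)) -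
          (c s₁ + ∫ τ in s₁..t, chartRep y₀ (X p₀ τ) (c τ)) =
          (φ x - c s₁) + ((∫ τ in s₁..t, chartRep y₀ (X p τ) (c τ)) -
            ∫ τ in s₁..t, chartRep y₀ (X p₀ τ) (c τ)) := by abel
      rw [h3]
      exact (norm_add_le _ _).trans (by linarith))
  have huB : ∀ t ∈ Icc a b, u t ∈ Bl := fun t ht =>
    hcB t ht (Metric.closedBall_subset_closedBall hρr (hu t ht).1)
  have hsub : uIcc s₁ s₂ ⊆ Icc a b := uIcc_subset_Icc_of_mem hs₁ hs₂
  refine ⟨fun t => φ.symm (u t), (isIntegralCurve_of_integral_eq hball hγ.subset huB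
    (hcar.integrableOn_comp huc huB) hs₁ fun t ht => (hu t ht).2).mono ordConnected_uIcc hsub,
    ?_, hρW _ (hu s₂ hs₂).1, fun t ht => mem_image_of_mem _ (huB t (hsub ht))⟩
  have : u s₁ = φ x := by rw [(hu s₁ hs₁).2]; simp
  simp only [this]
  exact φ.left_inv hx.1

variable [IsContMDiffRiemannianBundle 𝓘(ℝ, E) ∞ E (fun x : M => TangentSpace 𝓘(ℝ, E) x)]
  [CovariantDerivative.ContMDiffCovariantDerivative cov ∞]

/-- Local flows exist between nearby times of an integral curve. -/
theorem exists_pos_hasLocalFlow (hX : IsParamLocIntegrablyBounded cov T X) {A B : ℝ}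
    (hγ : IsIntegralCurve T (X p₀) (Icc A B) γ) {s : ℝ} (hs : s ∈ Icc A B) :
    ∃ d > 0, ∀ s₁ ∈ Icc A B ∩ Metric.ball s d, ∀ s₂ ∈ Icc A B ∩ Metric.ball s d,
      HasLocalFlow T X p₀ γ s₁ s₂ := by
  have hAB : A ≤ B := hs.1.trans hs.2
  obtain ⟨r, hr, C, -, hball2, hest⟩ := exists_chart_estimate cov (γ s)
  have hball := (Metric.closedBall_subset_closedBall (by linarith : r ≤ 2 * r)).trans hball2
  have hcont : ContinuousOn γ (Icc A B) := by
    have := hγ.locallyAC.continuousOn_uIcc (left_mem_Icc.2 hAB) (right_mem_Icc.2 hAB)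
    rwa [uIcc_of_le hAB] at this
  have hKint := (hX.locIntegrablyBounded p₀).integrable _ (isCompact_image_extChartAt_symm hball) _
    isCompact_Icc hγ.subset
  -- Half of the contraction budget `2⁻¹` is reserved for the perturbation in `p`.
  obtain ⟨δ, hδ, hsmall⟩ := exists_pos_setLIntegral_Icc_le (A := A) (B := B)
    (g := fun t => C * lipSeminorm cov ((extChartAt 𝓘(ℝ, E) (γ s)).symm ''
            Metric.closedBall (extChartAt 𝓘(ℝ, E) (γ s) (γ s)) r) (X p₀ t)) (by
      rw [lintegral_const_mul' _ _ (by simp)]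
      exact ENNReal.mul_lt_top (by simp) hKint.2) (ε := 4⁻¹) (by simp)
  obtain ⟨η, hη, hηmem⟩ := Metric.mem_nhdsWithin_iff.1
    (eventually_mem_chart_ball (E := E) (hcont s hs) (half_pos hr) rfl)
  let d := min (δ / 3) (η / 2)
  have hd : 0 < d := by positivity
  have hd1 : d ≤ δ / 3 := min_le_left _ _
  have hd2 : d ≤ η / 2 := min_le_right _ _
  have ha : s - d ≤ max A (s - d) := le_max_right _ _
  have hb : min B (s + d) ≤ s + d := min_le_right _ _
  have hsub : Icc (max A (s - d)) (min B (s + d)) ⊆ Icc A B :=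
    Icc_subset_Icc (le_max_left _ _) (min_le_left _ _)
  have hgood : ∀ t ∈ Icc (max A (s - d)) (min B (s + d)), _ := fun t ht =>
    hηmem (show t ∈ Metric.ball s η ∩ Icc A B from by
      refine ⟨?_, hsub ht⟩
      rw [Metric.mem_ball, Real.dist_eq, abs_lt]
      constructor <;> linarith [ht.1, ht.2])
  have hin : ∀ t ∈ Icc A B ∩ Metric.ball s d, t ∈ Icc (max A (s - d)) (min B (s + d)) := by
    intro t ht
    have h1 := ht.2
    rw [Metric.mem_ball, Real.dist_eq, abs_lt] at h1
    exact ⟨max_le ht.1.1 (by linarith), le_min ht.1.2 (by linarith)⟩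
  exact ⟨d, hd, fun s₁ h₁ s₂ h₂ => hasLocalFlow_of_chart cov hX hr hball2 hest
    (hγ.mono ordConnected_Icc hsub) (fun t ht => (hgood t ht).1) (fun t ht => (hgood t ht).2)
    (hsmall _ _ hsub (by linarith)) (hin s₁ h₁) (hin s₂ h₂)⟩

/-- Local flows exist along every integral curve on a compact interval. -/
theorem IsIntegralCurve.hasLocalFlow (hT : T.OrdConnected)
    (hX : IsParamLocIntegrablyBounded cov T X) {t₀ t₁ : ℝ}
    (hγ : IsIntegralCurve T (X p₀) (uIcc t₀ t₁) γ) : HasLocalFlow T X p₀ γ t₀ t₁ := by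
  choose! d hd hloc using fun s (hs : s ∈ uIcc t₀ t₁) => exists_pos_hasLocalFlow cov hX hγ hs
  -- A Lebesgue number makes the local step length uniform along `γ`.
  obtain ⟨δ, hδ, hleb⟩ := lebesgue_number_lemma_of_metric (c := fun s : uIcc t₀ t₁ =>
    Metric.ball (s : ℝ) (d s)) (isCompact_uIcc (a := t₀) (b := t₁)) (fun _ => Metric.isOpen_ball)
    (fun s hs => mem_iUnion.2 ⟨⟨s, hs⟩, Metric.mem_ball_self (hd s hs)⟩)
  have hnear : ∀ s₁ ∈ uIcc t₀ t₁, ∀ s₂ ∈ uIcc t₀ t₁, dist s₂ s₁ < δ →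
      HasLocalFlow T X p₀ γ s₁ s₂ := by
    intro s₁ h₁ s₂ h₂ h12
    obtain ⟨s, hs⟩ := hleb s₁ h₁
    exact hloc s s.2 s₁ ⟨h₁, hs (Metric.mem_ball_self hδ)⟩ s₂ ⟨h₂, hs h12⟩
  obtain ⟨n, hn⟩ := exists_nat_gt (|t₁ - t₀| / δ)
  have hn0 : (0 : ℝ) < n := lt_of_le_of_lt (by positivity) hn
  -- This equal partition has mesh below `δ` and treats both directions of time alike.
  let σ : ℕ → ℝ := fun k => t₀ + k / n * (t₁ - t₀)
  have hσn : σ n = t₁ := by simp [σ, div_self hn0.ne']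
  have hmem : ∀ k m : ℕ, k ≤ m → σ k ∈ uIcc t₀ (σ m) := by
    intro k m hkm
    have h1 : (k : ℝ) / n ≤ m / n := by gcongr
    have h2 : (0 : ℝ) ≤ k / n := by positivity
    rw [mem_uIcc]
    rcases le_total t₀ t₁ with h | h
    · exact Or.inl ⟨by simp only [σ]; nlinarith, by simp only [σ]; nlinarith⟩
    · exact Or.inr ⟨by simp only [σ]; nlinarith, by simp only [σ]; nlinarith⟩
  have hmem' : ∀ k ≤ n, σ k ∈ uIcc t₀ t₁ := fun k hk => hσn ▸ hmem k n hk
  have key : ∀ k ≤ n, HasLocalFlow T X p₀ γ t₀ (σ k) := by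
    intro k
    induction k with
    | zero => intro hk; exact hnear _ left_mem_uIcc _ (hmem' 0 hk) (by simpa [σ] using hδ)
    | succ k ih =>
      intro hk
      refine (ih (by omega)).trans hT (hmem k (k + 1) (by omega))
        (hnear _ (hmem' k (by omega)) _ (hmem' _ hk) ?_)
      have : σ (k + 1) - σ k = (t₁ - t₀) / n := by
        simp only [σ]; push_cast; field_simp; ring
      rw [Real.dist_eq, this, abs_div, abs_of_pos hn0, div_lt_iff₀ hn0, mul_comm]
      exact (div_lt_iff₀ hδ).1 hn
  exact hσn ▸ key n le_rfl

end LocalFlow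

/-! ### The flow and the main theorem. -/

section Flow

variable {E : Type*} [NormedAddCommGroup E] [NormedSpace ℝ E] [FiniteDimensional ℝ E]
  {M : Type*} [TopologicalSpace M] [ChartedSpace E M] [IsManifold 𝓘(ℝ, E) ∞ M]
  [RiemannianBundle (fun x : M => TangentSpace 𝓘(ℝ, E) x)]
  (cov : CovariantDerivative 𝓘(ℝ, E) E (TangentSpace 𝓘(ℝ, E) : M → Type _))
  [T2Space M]
  [IsContMDiffRiemannianBundle 𝓘(ℝ, E) ∞ E (fun x : M => TangentSpace 𝓘(ℝ, E) x)]
  [CovariantDerivative.ContMDiffCovariantDerivative cov ∞]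
  {P : Type*} {T : Set ℝ} {X : P → ℝ → Π x : M, TangentSpace 𝓘(ℝ, E) x} {p : P}

/-- The flow is given by any integral curve. -/
theorem IsIntegralCurve.eq_flow (hX : IsLocIntegrablyBounded cov T (X p)) {J : Set ℝ} {γ : ℝ → M}
    (hγ : IsIntegralCurve T (X p) J γ) {t₀ t : ℝ} (ht₀ : t₀ ∈ J) (ht : t ∈ J) :
    γ t = flow T X t t₀ (γ t₀) p := by
  have h : ∃ (γ' : ℝ → M) (J : Set ℝ),
      IsIntegralCurve T (X p) J γ' ∧ t₀ ∈ J ∧ t ∈ J ∧ γ' t₀ = γ t₀ := ⟨γ, J, hγ, ht₀, ht, rfl⟩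
  rw [flow, dif_pos h]
  obtain ⟨J', hγ', ht₀', ht', heq⟩ := h.choose_spec
  exact (hγ.mono ordConnected_uIcc (hγ.ordConnected.uIcc_subset ht₀ ht)).eqOn_Icc cov hX
    (hγ'.mono ordConnected_uIcc (hγ'.ordConnected.uIcc_subset ht₀' ht')) left_mem_uIcc heq.symm
    right_mem_uIcc

end Flow

end LipFlow

end

theorem corollary3p11
    {E : Type*} [NormedAddCommGroup E] [NormedSpace ℝ E] [FiniteDimensional ℝ E]
    {M : Type*} [TopologicalSpace M] [ChartedSpace E M] [IsManifold 𝓘(ℝ, E) ∞ M]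
    [T2Space M] [SecondCountableTopology M] [ConnectedSpace M]
    [RiemannianBundle (fun x : M => TangentSpace 𝓘(ℝ, E) x)]
    [IsContMDiffRiemannianBundle 𝓘(ℝ, E) ∞ E (fun x : M => TangentSpace 𝓘(ℝ, E) x)]
    (cov : CovariantDerivative 𝓘(ℝ, E) E (TangentSpace 𝓘(ℝ, E) : M → Type _))
    [CovariantDerivative.ContMDiffCovariantDerivative cov ∞] (hcov : LipFlow.IsMetricConnection cov)
    {P : Type*} [TopologicalSpace P]
    (T : Set ℝ) (hT : T.OrdConnected)
    (X : P → ℝ → Π x : M, TangentSpace 𝓘(ℝ, E) x)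
    (hX : LipFlow.IsParamLocIntegrablyBounded cov T X)
    (K : Set M) (hK : IsCompact K)
    (t₀ t₁ : ℝ) (ht₀ : t₀ ∈ T) (ht₁ : t₁ ∈ T) (p₀ : P)
    (hD : uIcc t₀ t₁ ×ˢ ({t₀} : Set ℝ) ×ˢ K ×ˢ ({p₀} : Set P) ⊆ LipFlow.flowDomain T X) :
    ∃ O : Set P, IsOpen O ∧ p₀ ∈ O ∧
      -- the flow is defined on `|t₀, t₁| × {t₀} × K × O`
      uIcc t₀ t₁ ×ˢ ({t₀} : Set ℝ) ×ˢ K ×ˢ O ⊆ LipFlow.flowDomain T X ∧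
      -- there, its value does not depend on the choice of an integral curve
      (∀ t ∈ uIcc t₀ t₁, ∀ x ∈ K, ∀ p ∈ O, ∀ (J : Set ℝ) (γ : ℝ → M),
        LipFlow.IsIntegralCurve T (X p) J γ → t₀ ∈ J → t ∈ J → γ t₀ = x →
          γ t = LipFlow.flow T X t t₀ x p) ∧
      -- its image is precompact
      IsCompact (closure {y : M | ∃ t ∈ uIcc t₀ t₁, ∃ x ∈ K, ∃ p ∈ O,
        LipFlow.flow T X t t₀ x p = y}) := by

  have hcurve : ∀ x ∈ K, ∃ V ∈ 𝓝 x, ∃ O ∈ 𝓝 p₀, ∃ C : Set M, IsCompact C ∧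
      ∀ y ∈ V, ∀ p ∈ O, ∃ β : ℝ → M, LipFlow.IsIntegralCurve T (X p) (uIcc t₀ t₁) β ∧ β t₀ = y ∧
        ∀ t ∈ uIcc t₀ t₁, β t ∈ C := by
    intro x hx
    -- A curve reaching `t₁` covers all intermediate times, so the final time is enough.
    have hmem : t₁ ∈ LipFlow.existenceInterval T X t₀ x p₀ :=
      (hD (a := (t₁, t₀, x, p₀)) ⟨right_mem_uIcc, rfl, hx, rfl⟩).2.2
    obtain ⟨J, ⟨γ, hγ, ht₀J, rfl⟩, ht₁J⟩ := hmem
    -- The end point is unconstrained, hence the target `univ`.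
    obtain ⟨V, hV, O, hO, C, hC, H⟩ := (hγ.mono ordConnected_uIcc
      (hγ.ordConnected.uIcc_subset ht₀J ht₁J)).hasLocalFlow cov hT hX univ univ_mem
    refine ⟨V, hV, O, hO, C, hC, fun y hy p hp => ?_⟩
    obtain ⟨β, h₁, h₂, -, h₃⟩ := H y hy p hp
    exact ⟨β, h₁, h₂, h₃⟩
  choose! V hV O hO C hC H using hcurve
  obtain ⟨F, hFK, hF⟩ := hK.elim_nhds_subcover V hV
  have hOF : (⋂ x ∈ F, O x) ∈ 𝓝 p₀ :=
    (biInter_finset_mem F).2 fun x hx => hO x (hFK x hx)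
  have hcurve : ∀ x ∈ K, ∀ p ∈ interior (⋂ x ∈ F, O x), ∃ β : ℝ → M,
      LipFlow.IsIntegralCurve T (X p) (uIcc t₀ t₁) β ∧ β t₀ = x ∧
        ∀ t ∈ uIcc t₀ t₁, β t ∈ ⋃ x ∈ F, C x := by
    intro x hx p hp
    obtain ⟨z, hz, hxz⟩ := mem_iUnion₂.1 (hF hx)
    obtain ⟨β, h₁, h₂, h₃⟩ := H z (hFK z hz) x hxz p (mem_iInter₂.1 (interior_subset hp) z hz)
    exact ⟨β, h₁, h₂, fun t ht => mem_iUnion₂.2 ⟨z, hz, h₃ t ht⟩⟩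
  refine ⟨interior (⋂ x ∈ F, O x), isOpen_interior, mem_interior_iff_mem_nhds.2 hOF, ?_, ?_, ?_⟩
  · rintro ⟨t, s, x, p⟩ ⟨ht, rfl : s = t₀, hx, hp⟩
    obtain ⟨β, h₁, h₂, -⟩ := hcurve x hx p hp
    exact ⟨h₁.subset ht, ht₀, _, ⟨β, h₁, left_mem_uIcc, h₂⟩, ht⟩
  · rintro t - x - p - J γ hγ ht₀J htJ rfl
    exact hγ.eq_flow cov (hX.locIntegrablyBounded p) ht₀J htJ
  · refine (F.isCompact_biUnion fun x hx => hC x (hFK x hx)).closure_of_subset ?_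
    rintro _ ⟨t, ht, x, hx, p, hp, rfl⟩
    obtain ⟨β, h₁, rfl, h₃⟩ := hcurve x hx p hp
    rw [← h₁.eq_flow cov (hX.locIntegrablyBounded p) left_mem_uIcc ht]
    exact h₃ t ht
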